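/- Let $a<b<c$ be natural numbers with $\gcd(a,b,c)=1$ such that the numbers $a^pb^qc^l$ $(p,q,l\in\mathbb N_0)$ are pairwise distinct (this holds, for instance, if $a\ge 2$ and $a,b,c$ are pairwise coprime). For real $x$ let $N_{a,b,c}(x)$ be the number of triples $(p,q,l)\in\mathbb N_0^3$ with $a^pb^qc^l\le x$, and let $\chi_{S_{a,b,c}}$ be the characteristic function of $S_{a,b,c}=\{a^pb^qc^l: p,q,l\in\mathbb N_0\}$. Let $B_1^*(\{y\})=\{y\}-\frac12$ for $y\notin\mathbb Z$ and $B_1^*(\{y\})=0$ for $y\in\mathbb Z$, where $\{y\}$ is the fractional part. For distinct $u,v,w\in\{a,b,c\}$ and real $x\ge 1$, $R>0$ put $$C_{u,v}(x;R)=\sum_{1\le k\le R\log u}\frac{\cos\left(\frac{\pi k\log v}{\log u}\right)\cos\left(2\pi k\frac{\log x}{\log u}\right)}{k\,\sin\left(\frac{\pi k\log v}{\log u}\right)},$$ $$D_{u;v,w}(x;R)=\sum_{1\le k\le R\log u}\frac{\cos\left(\frac{\pi k\log v}{\log u}\right)\cos\left(\frac{\pi k\log w}{\log u}\right)\sin\left(2\pi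 k\frac{\log x}{\log u}\right)}{k\,\sin\left(\frac{\pi k\log v}{\log u}\right)\sin\left(\frac{\pi k\log w}{\log u}\right)}.$$ For $\delta>0$ let $\mathcal R_\delta$ be the set of real $R$ for which each of $R\log a$, $R\log b$, $R\log c$ has distance at least $\delta$ from every integer. Then $\mathcal R_\delta$ is unbounded above for some $\delta>0$, and for every real $x\ge1$ there are real numbers $P_{a,b}(x),P_{b,c}(x),P_{a,c}(x),Q(x)$ such that, for every $\delta>0$, as $R\to\infty$ through $\mathcal R_\delta$, $$C_{u,v}(x;R)+C_{v,u}(x;R)\to P_{u,v}(x)\quad\text{for }(u,v)\in\{(a,b),(b,c),(a,c)\},$$ $$D_{a;b,c}(x;R)+D_{b;a,c}(x;R)+D_{c;a,b}(x;R)\to Q(x),$$ and $$\begin{aligned}N_{a,b,c}(x)={}&\frac{\log(x)^3}{6\log a\log b\log c}+\frac{\log(x)^2}{4\log a\log b}+\frac{\log(x)^2}{4\log a\log c}+\frac{\log(x)^2}{4\log b\log c}+\frac{\log x}{4\log a}+\frac{\log x}{4\log b}+\frac{\log x}{4\log c}\\&+\frac{\log a\log x}{12\log b\log c}+\frac{\log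 b\log x}{12\log a\log c}+\frac{\log c\log x}{12\log a\log b}+\frac{\log a}{24\log b}+\frac{\log a}{24\log c}+\frac{\log b}{24\log a}+\frac{\log b}{24\log c}+\frac{\log c}{24\log a}+\frac{\log c}{24\log b}+\frac18\\&-\frac14B_1^*\left(\left\{\frac{\log x}{\log a}\right\}\right)-\frac14B_1^*\left(\left\{\frac{\log x}{\log b}\right\}\right)-\frac14B_1^*\left(\left\{\frac{\log x}{\log c}\right\}\right)\\&-\frac1{4\pi}P_{a,b}(x)-\frac1{4\pi}P_{b,c}(x)-\frac1{4\pi}P_{a,c}(x)-\frac1{4\pi}Q(x)+\frac12\chi_{S_{a,b,c}}(x).\end{aligned}$$ In particular, all of this holds for $(a,b,c)=(2,3,5)$, which gives the formula for $N_{2,3,5}(x)$, $x\ge1$. -/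

import Mathlib

open Filter Topology

noncomputable section

/-- `N_{a,b,c}(x)`: the number of triples `(p, q, l)` of natural numbers with
`a ^ p * b ^ q * c ^ l ≤ x`. -/
def smoothCount (a b c : ℕ) (x : ℝ) : ℕ :=
  Set.ncard {t : ℕ × ℕ × ℕ | ((a ^ t.1 * b ^ t.2.1 * c ^ t.2.2 : ℕ) : ℝ) ≤ x}

/-- `S_{a,b,c}`: the numbers of the form `a ^ p * b ^ q * c ^ l`, as a set of real numbers. -/
def smoothSet (a b c : ℕ) : Set ℝ :=
  {y | ∃ p q l : ℕ, y = ((a ^ p * b ^ q * c ^ l : ℕ) : ℝ)}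

/-- The characteristic function of `S_{a,b,c}`. -/
def smoothChar (a b c : ℕ) (x : ℝ) : ℝ :=
  (smoothSet a b c).indicator (fun _ => (1 : ℝ)) x

/-- `B₁^*({y})`: it is `{y} - 1/2` if `y` is not an integer, and `0` if `y` is an integer. -/
def bernoulliOneStar (y : ℝ) : ℝ :=
  if Int.fract y = 0 then 0 else Int.fract y - 1 / 2

/-- The part of the formula that is a cubic polynomial in `log x`. -/
def cubicPart (a b c : ℕ) (x : ℝ) : ℝ :=
  Real.log x ^ 3 / (6 * Real.log a * Real.log b * Real.log c)
    + Real.log x ^ 2 / (4 * Real.log a * Real.log b)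
    + Real.log x ^ 2 / (4 * Real.log a * Real.log c)
    + Real.log x ^ 2 / (4 * Real.log b * Real.log c)
    + Real.log x / (4 * Real.log a)
    + Real.log x / (4 * Real.log b)
    + Real.log x / (4 * Real.log c)
    + Real.log a * Real.log x / (12 * Real.log b * Real.log c)
    + Real.log b * Real.log x / (12 * Real.log a * Real.log c)
    + Real.log c * Real.log x / (12 * Real.log a * Real.log b)
    + Real.log a / (24 * Real.log b) + Real.log a / (24 * Real.log c)
    + Real.log b / (24 * Real.log a) + Real.log b / (24 * Real.log c)
    + Real.log c / (24 * Real.log a) + Real.log c / (24 * Real.log b)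
    + 1 / 8

/-- The sum over `1 ≤ k ≤ ⌊R log a⌋` of
`cot (π k log b / log a) * cos (2 π k log x / log a) / k`. -/
def cotCosSum (a b : ℕ) (x R : ℝ) : ℝ :=
  ∑ k ∈ Finset.Icc 1 ⌊R * Real.log a⌋₊,
    Real.cos (Real.pi * k * Real.log b / Real.log a)
        * Real.cos (2 * Real.pi * k * (Real.log x / Real.log a))
      / (k * Real.sin (Real.pi * k * Real.log b / Real.log a))

/-- The sum over `1 ≤ k ≤ ⌊R log a⌋` of
`cot (π k log b / log a) * cot (π k log c / log a) * sin (2 π k log x / log a) / k`. -/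
def cotCotSinSum (a b c : ℕ) (x R : ℝ) : ℝ :=
  ∑ k ∈ Finset.Icc 1 ⌊R * Real.log a⌋₊,
    Real.cos (Real.pi * k * Real.log b / Real.log a)
        * Real.cos (Real.pi * k * Real.log c / Real.log a)
        * Real.sin (2 * Real.pi * k * (Real.log x / Real.log a))
      / (k * Real.sin (Real.pi * k * Real.log b / Real.log a)
          * Real.sin (Real.pi * k * Real.log c / Real.log a))

/-- `R → ∞` through the real numbers for which each of `R log a`, `R log b`, `R log c` has
distance at least `δ` from every integer. -/
def separatedAtTop (a b c : ℕ) (δ : ℝ) : Filter ℝ :=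
  atTop ⊓ 𝓟 {R : ℝ | ∀ m : ℤ, δ ≤ |R * Real.log a - m| ∧ δ ≤ |R * Real.log b - m| ∧
    δ ≤ |R * Real.log c - m|}

end

/-!
For positive reals `α j` whose ratios are irrational and for `0 ≤ u`, let `H` be the number of
lattice points `n` with `∑ j, n j * α j ≤ u`, where a point on the boundary counts for one half.
Multiplying out the geometric series, `F s = e ^ (u s) / ∏ j, (1 - e ^ (-α j s))` is for large
`s.re` the sum of the `e ^ ((u - ∑ j, n j * α j) s)`; let `G` be `F` minus the terms with a
nonnegative exponent, a constant term being halved. Away from the poles `G s + G (-s)` is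
exponentially small in `|s.re|`, so pairing opposite boundary points shows that the integral of
`G s / s` over large rectangles centred at `0` tends to `0`, as long as their sides stay away from
the poles. The residue of `G s / s` at `0` is a polynomial in `u` minus `H`, and the residues at the
other poles `2 π i k / α j` add up to finite trigonometric sums, which therefore converge to `H`
minus the polynomial.

With `α j` the logarithms of integers, three bases give the formula for `N_{a,b,c}`. Subsets of two
and of one of the bases show that the sums over the cotangents of two of the bases converge
separately, and that the sums without cotangents converge to `-π B₁^*`.
-/

section Rectangle

open Complex Set
open MeasureTheory (volume)
open scoped Interval

/-- The integral of `f` over the positively oriented boundary of the rectangle with opposite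
corners `z` and `w`, with the sides grouped as in Mathlib's Cauchy theorem for rectangles. -/
noncomputable def rectIntegral (f : ℂ → ℂ) (z w : ℂ) : ℂ :=
  (∫ x : ℝ in z.re..w.re, f (x + z.im * I)) - (∫ x : ℝ in z.re..w.re, f (x + w.im * I))
    + I • (∫ y : ℝ in z.im..w.im, f (w.re + y * I)) - I • ∫ y : ℝ in z.im..w.im, f (z.re + y * I)

/-- The boundary of the rectangle with opposite corners `z` and `w`. -/
def rectBoundary (z w : ℂ) : Set ℂ :=
  ([[z.re, w.re]] ×ℂ {z.im, w.im}) ∪ ({z.re, w.re} ×ℂ [[z.im, w.im]])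

variable {f g : ℂ → ℂ} {z w : ℂ}

lemma mem_rectBoundary {ζ : ℂ} :
    ζ ∈ rectBoundary z w ↔ ζ.re ∈ [[z.re, w.re]] ∧ (ζ.im = z.im ∨ ζ.im = w.im) ∨
      (ζ.re = z.re ∨ ζ.re = w.re) ∧ ζ.im ∈ [[z.im, w.im]] := by
  simp [rectBoundary, mem_reProdIm]

lemma horizontal_mem_rectBoundary {x y : ℝ} (hx : x ∈ [[z.re, w.re]])
    (hy : y = z.im ∨ y = w.im) : (x + y * I : ℂ) ∈ rectBoundary z w :=
  mem_rectBoundary.2 (Or.inl ⟨by simpa using hx, by simpa using hy⟩)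

lemma vertical_mem_rectBoundary {x y : ℝ} (hx : x = z.re ∨ x = w.re)
    (hy : y ∈ [[z.im, w.im]]) : (x + y * I : ℂ) ∈ rectBoundary z w :=
  mem_rectBoundary.2 (Or.inr ⟨by simpa using hx, by simpa using hy⟩)

lemma rectBoundary_subset : rectBoundary z w ⊆ [[z.re, w.re]] ×ℂ [[z.im, w.im]] := by
  intro ζ hζ
  rcases mem_rectBoundary.1 hζ with ⟨hre, him | him⟩ | ⟨hre | hre, him⟩ <;>
    simp_all [mem_reProdIm]

lemma ne_of_mem_rectBoundary {ζ p : ℂ} (hζ : ζ ∈ rectBoundary z w)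
    (hp : p ∈ Ioo z.re w.re ×ℂ Ioo z.im w.im) : ζ ≠ p := by
  rintro rfl
  obtain ⟨hre, him⟩ := mem_reProdIm.1 hp
  rcases mem_rectBoundary.1 hζ with ⟨-, h | h⟩ | ⟨h | h, -⟩
  exacts [him.1.ne' h, him.2.ne h, hre.1.ne' h, hre.2.ne h]

lemma neg_mem_rectBoundary {ζ : ℂ} (hζ : ζ ∈ rectBoundary (-w) w) :
    -ζ ∈ rectBoundary (-w) w := by
  simp only [mem_rectBoundary, neg_re, neg_im, mem_uIcc] at hζ ⊢
  grind

lemma intervalIntegrable_horizontal {y : ℝ} (hy : y = z.im ∨ y = w.im)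
    (hf : ContinuousOn f (rectBoundary z w)) :
    IntervalIntegrable (fun x : ℝ => f (x + y * I)) volume z.re w.re :=
  (hf.comp (by fun_prop) fun _ hx => horizontal_mem_rectBoundary hx hy).intervalIntegrable

lemma intervalIntegrable_vertical {x : ℝ} (hx : x = z.re ∨ x = w.re)
    (hf : ContinuousOn f (rectBoundary z w)) :
    IntervalIntegrable (fun y : ℝ => f (x + y * I)) volume z.im w.im :=
  (hf.comp (by fun_prop) fun _ hy => vertical_mem_rectBoundary hx hy).intervalIntegrable

lemma rectIntegral_sub (hf : ContinuousOn f (rectBoundary z w))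
    (hg : ContinuousOn g (rectBoundary z w)) :
    rectIntegral (fun ζ => f ζ - g ζ) z w = rectIntegral f z w - rectIntegral g z w := by
  have hor {y : ℝ} (hy : y = z.im ∨ y = w.im) :=
    intervalIntegral.integral_sub (intervalIntegrable_horizontal hy hf)
      (intervalIntegrable_horizontal hy hg)
  have ver {x : ℝ} (hx : x = z.re ∨ x = w.re) :=
    intervalIntegral.integral_sub (intervalIntegrable_vertical hx hf)
      (intervalIntegrable_vertical hx hg)
  simp only [rectIntegral, smul_eq_mul]
  rw [hor (.inl rfl), hor (.inr rfl), ver (.inl rfl), ver (.inr rfl)]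
  ring

lemma rectIntegral_sum {κ : Type*} (S : Finset κ) {f : κ → ℂ → ℂ}
    (hf : ∀ i ∈ S, ContinuousOn (f i) (rectBoundary z w)) :
    rectIntegral (fun ζ => ∑ i ∈ S, f i ζ) z w = ∑ i ∈ S, rectIntegral (f i) z w := by
  have hor {y : ℝ} (hy : y = z.im ∨ y = w.im) := intervalIntegral.integral_finsetSum
    fun i hi => intervalIntegrable_horizontal hy (hf i hi)
  have ver {x : ℝ} (hx : x = z.re ∨ x = w.re) := intervalIntegral.integral_finsetSum
    fun i hi => intervalIntegrable_vertical hx (hf i hi)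
  simp only [rectIntegral, smul_eq_mul]
  rw [hor (.inl rfl), hor (.inr rfl), ver (.inl rfl), ver (.inr rfl)]
  simp only [Finset.sum_add_distrib, Finset.sum_sub_distrib, Finset.mul_sum]

lemma rectIntegral_const_mul (c : ℂ) (f : ℂ → ℂ) :
    rectIntegral (fun ζ => c * f ζ) z w = c * rectIntegral f z w := by
  simp only [rectIntegral, intervalIntegral.integral_const_mul, smul_eq_mul]
  ring

lemma rectIntegral_congr (h : EqOn f g (rectBoundary z w)) :
    rectIntegral f z w = rectIntegral g z w := by
  have hor {y : ℝ} (hy : y = z.im ∨ y = w.im) :=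
    intervalIntegral.integral_congr (μ := volume)
      fun x (hx : x ∈ [[z.re, w.re]]) => h (horizontal_mem_rectBoundary hx hy)
  have ver {x : ℝ} (hx : x = z.re ∨ x = w.re) :=
    intervalIntegral.integral_congr (μ := volume)
      fun y (hy : y ∈ [[z.im, w.im]]) => h (vertical_mem_rectBoundary hx hy)
  simp only [rectIntegral]
  rw [hor (.inl rfl), hor (.inr rfl), ver (.inl rfl), ver (.inr rfl)]

lemma integral_horizontal_eq_sub {F : ℂ → ℂ} {a b y : ℝ}
    (hF : ∀ x ∈ [[a, b]], HasDerivAt F (f (x + y * I)) (x + y * I))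
    (hf : IntervalIntegrable (fun x : ℝ => f (x + y * I)) volume a b) :
    ∫ x : ℝ in a..b, f (x + y * I) = F (b + y * I) - F (a + y * I) := by
  refine intervalIntegral.integral_eq_sub_of_hasDerivAt
    (f := fun x : ℝ => F (x + y * I)) (fun x hx => ?_) hf
  have hline : HasDerivAt (fun x : ℝ => (x : ℂ) + y * I) 1 x :=
    (ofRealCLM.hasDerivAt (x := x)).add_const _
  have hcomp := (hF x hx).comp x hline
  rwa [mul_one] at hcomp

lemma integral_vertical_eq_sub {F : ℂ → ℂ} {a b x : ℝ}
    (hF : ∀ y ∈ [[a, b]], HasDerivAt F (f (x + y * I)) (x + y * I))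
    (hf : IntervalIntegrable (fun y : ℝ => f (x + y * I)) volume a b) :
    I • ∫ y : ℝ in a..b, f (x + y * I) = F (x + b * I) - F (x + a * I) := by
  rw [← intervalIntegral.integral_smul]
  refine intervalIntegral.integral_eq_sub_of_hasDerivAt
    (f := fun y : ℝ => F (x + y * I)) (fun y hy => ?_) (hf.smul I)
  have hline : HasDerivAt (fun y : ℝ => (x : ℂ) + y * I) I y := by
    simpa using ((ofRealCLM.hasDerivAt (x := y)).mul_const I).const_add (x : ℂ)
  have hcomp := (hF y hy).comp y hline
  rwa [mul_comm] at hcomp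

lemma rectIntegral_eq_zero_of_hasDerivAt {F : ℂ → ℂ}
    (hF : ∀ ζ ∈ rectBoundary z w, HasDerivAt F (f ζ) ζ)
    (hf : ContinuousOn f (rectBoundary z w)) : rectIntegral f z w = 0 := by
  have hor {y : ℝ} (hy : y = z.im ∨ y = w.im) := integral_horizontal_eq_sub
    (fun x hx => hF _ (horizontal_mem_rectBoundary hx hy)) (intervalIntegrable_horizontal hy hf)
  have ver {x : ℝ} (hx : x = z.re ∨ x = w.re) := integral_vertical_eq_sub
    (fun y hy => hF _ (vertical_mem_rectBoundary hx hy)) (intervalIntegrable_vertical hx hf)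
  rw [rectIntegral, hor (.inl rfl), hor (.inr rfl), ver (.inl rfl), ver (.inr rfl)]
  ring

lemma log_sub_log_neg_of_im_pos {v : ℂ} (hv : 0 < v.im) : log v - log (-v) = Real.pi * I := by
  apply Complex.ext
  · simp [log_re]
  · simp [log_im, arg_neg_eq_arg_sub_pi_of_im_pos hv]

/- The principal branch of `log (ζ - p)` is a primitive on three sides of the rectangle and
`log (p - ζ)` is one on the left side; the two differ by `±πi` at the two left corners. -/
lemma rectIntegral_inv_sub {p : ℂ} (hp : p ∈ Ioo z.re w.re ×ℂ Ioo z.im w.im) :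
    rectIntegral (fun ζ => (ζ - p)⁻¹) z w = 2 * Real.pi * I := by
  have hf : ContinuousOn (fun ζ : ℂ => (ζ - p)⁻¹) (rectBoundary z w) :=
    ContinuousOn.inv₀ (by fun_prop) fun ζ hζ => sub_ne_zero.2 (ne_of_mem_rectBoundary hζ hp)
  have hlog (ζ : ℂ) (hζ : ζ - p ∈ slitPlane) :
      HasDerivAt (fun ζ => log (ζ - p)) ((ζ - p)⁻¹) ζ := by
    simpa using ((hasDerivAt_id ζ).sub_const p).clog hζ
  have hlog_neg (ζ : ℂ) (hζ : p - ζ ∈ slitPlane) :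
      HasDerivAt (fun ζ => log (p - ζ)) ((ζ - p)⁻¹) ζ := by
    rw [← neg_sub p ζ, inv_neg]
    simpa [neg_div] using ((hasDerivAt_id ζ).const_sub p).clog hζ
  obtain ⟨⟨hre₁, hre₂⟩, him₁, him₂⟩ := mem_reProdIm.1 hp
  have bottom := integral_horizontal_eq_sub
    (fun x _ => hlog _ (.inr (by simpa using (sub_neg.2 him₁).ne)))
    (intervalIntegrable_horizontal (.inl rfl) hf)
  have top := integral_horizontal_eq_sub
    (fun x _ => hlog _ (.inr (by simpa using (sub_pos.2 him₂).ne')))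
    (intervalIntegrable_horizontal (.inr rfl) hf)
  have right := integral_vertical_eq_sub (fun y _ => hlog _ (.inl (by simpa using hre₂)))
    (intervalIntegrable_vertical (.inr rfl) hf)
  have left := integral_vertical_eq_sub (fun y _ => hlog_neg _ (.inl (by simpa using hre₁)))
    (intervalIntegrable_vertical (.inl rfl) hf)
  have upper := log_sub_log_neg_of_im_pos (v := z.re + w.im * I - p) (by simpa using him₂)
  have lower := log_sub_log_neg_of_im_pos (v := p - (z.re + z.im * I)) (by simpa using him₁)
  rw [neg_sub] at upper lower
  rw [rectIntegral, bottom, top, right, left]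
  linear_combination upper + lower

lemma rectIntegral_inv_sub_pow {p : ℂ} (hp : p ∈ Ioo z.re w.re ×ℂ Ioo z.im w.im) {n : ℕ}
    (hn : n ≠ 1) : rectIntegral (fun ζ => (ζ - p)⁻¹ ^ n) z w = 0 := by
  have hne (ζ : ℂ) (hζ : ζ ∈ rectBoundary z w) : ζ - p ≠ 0 :=
    sub_ne_zero.2 (ne_of_mem_rectBoundary hζ hp)
  have hn' : ((1 - n : ℤ) : ℂ) ≠ 0 := Int.cast_ne_zero.2 (by omega)
  refine rectIntegral_eq_zero_of_hasDerivAt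
    (F := fun ζ => (ζ - p) ^ (1 - n : ℤ) / ((1 - n : ℤ) : ℂ)) (fun ζ hζ => ?_)
    ((ContinuousOn.inv₀ (by fun_prop) hne).pow n)
  have := ((hasDerivAt_zpow (1 - n : ℤ) (ζ - p) (.inl (hne ζ hζ))).comp_sub_const ζ p).div_const
    ((1 - n : ℤ) : ℂ)
  rwa [mul_div_cancel_left₀ _ hn', sub_sub_cancel_left, zpow_neg, zpow_natCast, ← inv_pow]
    at this

lemma continuousOn_eval_inv_sub {p : ℂ} (P : Polynomial ℂ)
    (hp : p ∈ Ioo z.re w.re ×ℂ Ioo z.im w.im) :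
    ContinuousOn (fun ζ => P.eval (ζ - p)⁻¹) (rectBoundary z w) :=
  P.continuous.comp_continuousOn <| ContinuousOn.inv₀ (by fun_prop)
    fun _ hζ => sub_ne_zero.2 (ne_of_mem_rectBoundary hζ hp)

lemma rectIntegral_eval_inv_sub {p : ℂ} (hp : p ∈ Ioo z.re w.re ×ℂ Ioo z.im w.im)
    (P : Polynomial ℂ) :
    rectIntegral (fun ζ => P.eval (ζ - p)⁻¹) z w = 2 * Real.pi * I * P.coeff 1 := by
  have hcont (n : ℕ) : ContinuousOn (fun ζ => P.coeff n * (ζ - p)⁻¹ ^ n) (rectBoundary z w) := by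
    simpa using continuousOn_eval_inv_sub (.monomial n (P.coeff n)) hp
  simp only [P.eval_eq_sum_range' (Nat.lt_add_of_pos_right two_pos)]
  rw [rectIntegral_sum _ fun n _ => hcont n, Finset.sum_eq_single 1]
  · simp only [rectIntegral_const_mul, pow_one, rectIntegral_inv_sub hp]
    ring
  · intro n _ hn
    rw [rectIntegral_const_mul, rectIntegral_inv_sub_pow hp hn, mul_zero]
  · simp

lemma isBigO_one_of_continuousAt {p : ℂ} (hg : ContinuousAt g p) :
    g =O[𝓝[≠] p] fun _ => (1 : ℂ) :=
  hg.continuousWithinAt.tendsto.isBigO_one ℂ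

lemma meromorphicOrderAt_nonneg_of_isBigO_one {p : ℂ}
    (hf : f =O[𝓝[≠] p] (fun _ => (1 : ℂ))) : 0 ≤ meromorphicOrderAt f p := by
  by_contra! h
  have hcobounded := tendsto_norm_cobounded_atTop.comp
    (tendsto_cobounded_of_meromorphicOrderAt_neg h)
  exact not_isBoundedUnder_of_tendsto_atTop hcobounded ((Asymptotics.isBigO_one_iff ℂ).1 hf)

lemma rectIntegral_eq_zero_of_isBigO_one (hf : MeromorphicOn f ([[z.re, w.re]] ×ℂ [[z.im, w.im]]))
    (hbdd : ∀ p ∈ [[z.re, w.re]] ×ℂ [[z.im, w.im]], f =O[𝓝[≠] p] (fun _ => (1 : ℂ)))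
    (hbdry : AnalyticOnNhd ℂ f (rectBoundary z w)) : rectIntegral f z w = 0 := by
  set U := [[z.re, w.re]] ×ℂ [[z.im, w.im]]
  have hdiff : DifferentiableOn ℂ (toMeromorphicNFOn f U) U := fun p hp => by
    have := (meromorphicNFOn_toMeromorphicNFOn f U hp).meromorphicOrderAt_nonneg_iff_analyticAt
    rw [meromorphicOrderAt_toMeromorphicNFOn hf hp] at this
    exact (this.1 (meromorphicOrderAt_nonneg_of_isBigO_one (hbdd p hp))).differentiableAt
      |>.differentiableWithinAt
  rw [rectIntegral_congr (g := toMeromorphicNFOn f U), rectIntegral,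
    integral_boundary_rect_eq_zero_of_differentiableOn _ _ _ hdiff]
  intro p hp
  rw [toMeromorphicNFOn_eq_toMeromorphicNFAt hf (rectBoundary_subset hp),
    toMeromorphicNFAt_eq_self.2 (hbdry p hp).meromorphicNFAt]

theorem rectIntegral_eq_sum_coeff {κ : Type*} {S : Finset κ} {pole : κ → ℂ}
    {P : κ → Polynomial ℂ} (hinj : InjOn pole S)
    (hpole : ∀ i ∈ S, pole i ∈ Ioo z.re w.re ×ℂ Ioo z.im w.im)
    (hf : MeromorphicOn f ([[z.re, w.re]] ×ℂ [[z.im, w.im]]))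
    (hreg : ∀ ζ ∈ [[z.re, w.re]] ×ℂ [[z.im, w.im]], (∀ i ∈ S, ζ ≠ pole i) → AnalyticAt ℂ f ζ)
    (hP : ∀ i ∈ S, (fun ζ => f ζ - (P i).eval (ζ - pole i)⁻¹)
      =O[𝓝[≠] (pole i)] (fun _ => (1 : ℂ))) :
    rectIntegral f z w = 2 * Real.pi * I * ∑ i ∈ S, (P i).coeff 1 := by
  classical
  have hpart (i : κ) (ζ : ℂ) (hζ : ζ ≠ pole i) :
      AnalyticAt ℂ (fun ζ => (P i).eval (ζ - pole i)⁻¹) ζ :=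
    (AnalyticOnNhd.eval_polynomial (P i) _ (mem_univ _)).comp (f := fun ζ => (ζ - pole i)⁻¹)
      ((analyticAt_id.sub analyticAt_const).inv (sub_ne_zero.2 hζ))
  have hmero (i : κ) (ζ : ℂ) : MeromorphicAt (fun ζ => (P i).eval (ζ - pole i)⁻¹) ζ := by
    simp only [Polynomial.eval_eq_sum, Polynomial.sum]
    fun_prop
  have hbdry (ζ : ℂ) (hζ : ζ ∈ rectBoundary z w) : AnalyticAt ℂ f ζ :=
    hreg ζ (rectBoundary_subset hζ) fun i hi => ne_of_mem_rectBoundary hζ (hpole i hi)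
  have hzero : rectIntegral (fun ζ => f ζ - ∑ i ∈ S, (P i).eval (ζ - pole i)⁻¹) z w = 0 := by
    refine rectIntegral_eq_zero_of_isBigO_one
      (fun ζ hζ => (hf ζ hζ).sub (.fun_sum fun i _ => hmero i ζ)) (fun ζ hζ => ?_)
      fun ζ hζ => (hbdry ζ hζ).sub (Finset.analyticAt_fun_sum _ fun i hi =>
        hpart i ζ (ne_of_mem_rectBoundary hζ (hpole i hi)))
    by_cases h : ∀ i ∈ S, ζ ≠ pole i
    · exact isBigO_one_of_continuousAt ((hreg ζ hζ h).sub
        (Finset.analyticAt_fun_sum _ fun i hi => hpart i ζ (h i hi))).continuousAt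
    · push Not at h
      obtain ⟨i, hi, rfl⟩ := h
      have hrest : AnalyticAt ℂ (fun ζ => ∑ j ∈ S.erase i, (P j).eval (ζ - pole j)⁻¹) (pole i) :=
        Finset.analyticAt_fun_sum _ fun j hj => hpart j _ fun h =>
          Finset.ne_of_mem_erase hj (hinj hi (Finset.mem_of_mem_erase hj) h).symm
      refine ((hP i hi).sub (isBigO_one_of_continuousAt hrest.continuousAt)).congr_left fun ζ => ?_
      rw [sub_sub, Finset.add_sum_erase S (fun j => (P j).eval (ζ - pole j)⁻¹) hi]
  rw [rectIntegral_sub (fun ζ hζ => (hbdry ζ hζ).continuousAt.continuousWithinAt)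
      (continuousOn_finsetSum _ fun i hi => continuousOn_eval_inv_sub (P i) (hpole i hi)),
    rectIntegral_sum _ fun i hi => continuousOn_eval_inv_sub (P i) (hpole i hi), sub_eq_zero]
    at hzero
  rw [hzero, Finset.mul_sum]
  exact Finset.sum_congr rfl fun i hi => rectIntegral_eval_inv_sub (hpole i hi) (P i)

lemma rectIntegral_neg_self (hf : ContinuousOn f (rectBoundary (-w) w)) :
    rectIntegral f (-w) w =
      (∫ x : ℝ in (-w).re..w.re, (f (x + (-w).im * I) - f (-(x + (-w).im * I))))
        + I • ∫ y : ℝ in (-w).im..w.im, (f (w.re + y * I) - f (-(w.re + y * I))) := by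
  have top : ∫ x : ℝ in (-w).re..w.re, f (x + w.im * I)
      = ∫ x : ℝ in (-w).re..w.re, f (-(x + (-w).im * I)) := by
    simpa [add_comm] using (intervalIntegral.integral_comp_neg
      (a := -w.re) (b := w.re) fun x : ℝ => f (x + w.im * I)).symm
  have left : ∫ y : ℝ in (-w).im..w.im, f ((-w).re + y * I)
      = ∫ y : ℝ in (-w).im..w.im, f (-(w.re + y * I)) := by
    simpa [add_comm] using (intervalIntegral.integral_comp_neg
      (a := -w.im) (b := w.im) fun y : ℝ => f ((-w).re + y * I)).symm
  have hneg : ContinuousOn (fun ζ => f (-ζ)) (rectBoundary (-w) w) :=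
    hf.comp continuousOn_neg fun _ hζ => neg_mem_rectBoundary hζ
  rw [intervalIntegral.integral_sub (intervalIntegrable_horizontal (.inl rfl) hf)
      (intervalIntegrable_horizontal (.inl rfl) hneg),
    intervalIntegral.integral_sub (intervalIntegrable_vertical (.inr rfl) hf)
      (intervalIntegrable_vertical (.inr rfl) hneg), ← top, ← left, smul_sub]
  simp only [rectIntegral, neg_re, neg_im]
  ring

/- Pairing `ζ` with `-ζ` turns `h ζ / ζ` into `(h ζ + h (-ζ)) / ζ`, so that opposite constants on
the two vertical sides cancel. -/
lemma norm_rectIntegral_div_le {h : ℂ → ℂ} {B ε : ℝ} (hre : 0 < w.re) (him : 0 < w.im)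
    (hh : ContinuousOn h (rectBoundary (-w) w))
    (hB : ∀ ζ ∈ rectBoundary (-w) w, ‖h ζ + h (-ζ)‖ ≤ B)
    (hε : ∀ ζ ∈ rectBoundary (-w) w, ζ.re = w.re → ‖h ζ + h (-ζ)‖ ≤ ε) :
    ‖rectIntegral (fun ζ => h ζ / ζ) (-w) w‖ ≤ 2 * w.re * (B / w.im) + 2 * w.im * (ε / w.re) := by
  have hpair (ζ : ℂ) : h ζ / ζ - h (-ζ) / -ζ = (h ζ + h (-ζ)) / ζ := by ring
  have hcorner : w ∈ rectBoundary (-w) w := mem_rectBoundary.2 (.inr ⟨.inr rfl, right_mem_uIcc⟩)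
  have hB0 : 0 ≤ B := (norm_nonneg _).trans (hB w hcorner)
  have hε0 : 0 ≤ ε := (norm_nonneg _).trans (hε w hcorner rfl)
  have hne (ζ : ℂ) (hζ : ζ ∈ rectBoundary (-w) w) : ζ ≠ 0 :=
    ne_of_mem_rectBoundary hζ (by simp [mem_reProdIm, hre, him])
  have hbottom : ‖∫ x : ℝ in (-w).re..w.re,
      (h (x + (-w).im * I) + h (-(x + (-w).im * I))) / (x + (-w).im * I)‖
        ≤ B / w.im * |w.re - (-w).re| := by
    refine intervalIntegral.norm_integral_le_of_norm_le_const fun x hx => ?_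
    rw [norm_div]
    refine div_le_div₀ hB0
      (hB _ (horizontal_mem_rectBoundary (uIoc_subset_uIcc hx) (.inl rfl))) him ?_
    simpa [abs_of_pos him] using abs_im_le_norm (x + (-w).im * I)
  have hright : ‖∫ y : ℝ in (-w).im..w.im,
      (h (w.re + y * I) + h (-(w.re + y * I))) / (w.re + y * I)‖
        ≤ ε / w.re * |w.im - (-w).im| := by
    refine intervalIntegral.norm_integral_le_of_norm_le_const fun y hy => ?_
    rw [norm_div]
    refine div_le_div₀ hε0
      (hε _ (vertical_mem_rectBoundary (.inr rfl) (uIoc_subset_uIcc hy)) (by simp)) hre ?_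
    simpa [abs_of_pos hre] using abs_re_le_norm (w.re + y * I)
  rw [neg_re, sub_neg_eq_add, ← two_mul, abs_of_pos (by positivity), ← neg_re] at hbottom
  rw [neg_im, sub_neg_eq_add, ← two_mul, abs_of_pos (by positivity), ← neg_im] at hright
  rw [rectIntegral_neg_self (f := fun ζ => h ζ / ζ) (hh.div continuousOn_id hne)]
  simp only [hpair]
  refine (norm_add_le _ _).trans ?_
  rw [norm_smul, norm_I, one_mul]
  linarith

end Rectangle

section Lattice

open Complex

variable {ι : Type*} [Fintype ι]

/-- The linear form `∑ j, n j * α j`, evaluated at a lattice point of the positive orthant. -/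
noncomputable def linForm (α : ι → ℝ) (n : ι → ℕ) : ℝ := ∑ j, n j * α j

/-- The Heaviside step function, with the value `1 / 2` at the jump. -/
noncomputable def halfStep (y : ℝ) : ℝ := (1 + Real.sign y) / 2

/-- The number of lattice points `n` with `linForm α n ≤ u`, where a point with `linForm α n = u`
counts for one half. -/
noncomputable def halfCount (α : ι → ℝ) (u : ℝ) : ℝ := ∑ᶠ n : ι → ℕ, halfStep (u - linForm α n)

/-- The function `e ^ (u s) / ∏ j, (1 - e ^ (-α j s))`, which for `0 < s.re` is the sum of
`e ^ ((u - linForm α n) s)` over all lattice points `n`. -/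
noncomputable def expKernel (α : ι → ℝ) (u : ℝ) (s : ℂ) : ℂ :=
  exp (u * s) * ∏ j, (1 - exp (-(α j * s)))⁻¹

lemma halfStep_of_neg {y : ℝ} (hy : y < 0) : halfStep y = 0 := by
  simp [halfStep, Real.sign_of_neg hy]

lemma halfStep_of_pos {y : ℝ} (hy : 0 < y) : halfStep y = 1 := by
  simp [halfStep, Real.sign_of_pos hy]

lemma halfStep_zero : halfStep 0 = 1 / 2 := by
  simp [halfStep]

lemma halfStep_neg (y : ℝ) : halfStep (-y) = 1 - halfStep y := by
  simp only [halfStep, Real.sign_neg]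
  ring

lemma norm_exp_ofReal_mul (y : ℝ) (s : ℂ) : ‖exp (y * s)‖ = Real.exp (y * s.re) := by
  rw [norm_exp, re_ofReal_mul]

lemma norm_exp_neg_ofReal_mul (y : ℝ) (s : ℂ) : ‖exp (-(y * s))‖ = Real.exp (-(y * s.re)) := by
  rw [norm_exp, neg_re, re_ofReal_mul]

lemma norm_halfStep_exp_sub_le {d y : ℝ} (hy : y ≠ 0 → d ≤ |y|) {s : ℂ} (hs : 0 ≤ s.re) :
    ‖(halfStep (-y) * exp (y * s) - halfStep y * exp (-(y * s)) : ℂ)‖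
      ≤ Real.exp (-(d * s.re)) := by
  rcases lt_trichotomy y 0 with h | rfl | h
  · have hd := mul_le_mul_of_nonneg_right (abs_of_neg h ▸ hy h.ne) hs
    simp only [halfStep_of_pos (neg_pos.2 h), halfStep_of_neg h, ofReal_one, one_mul, ofReal_zero,
      zero_mul, sub_zero, norm_exp_ofReal_mul, Real.exp_le_exp]
    linarith
  · simpa using Real.exp_nonneg _
  · have hd := mul_le_mul_of_nonneg_right (abs_of_pos h ▸ hy h.ne') hs
    simpa only [halfStep_of_neg (neg_neg_of_pos h), halfStep_of_pos h, ofReal_one, one_mul,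
      ofReal_zero, zero_mul, zero_sub, norm_neg, norm_exp_neg_ofReal_mul, Real.exp_le_exp,
      neg_le_neg_iff] using hd

lemma norm_one_sub_prod_one_sub_le {x : ι → ℂ} {ε : ℝ} (hε : ε ≤ 1) (hx : ∀ j, ‖x j‖ ≤ ε) :
    ‖1 - ∏ j, (1 - x j)‖ ≤ Fintype.card ι * Real.exp (Fintype.card ι) * ε := by
  set S := ∑ j, ‖x j‖
  have hS : S ≤ Fintype.card ι * ε := by
    simpa using Finset.sum_le_card_nsmul Finset.univ (fun j => ‖x j‖) ε fun j _ => hx j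
  have hS0 : 0 ≤ S := Finset.sum_nonneg fun _ _ => norm_nonneg _
  have hexp : Real.exp S - 1 ≤ S * Real.exp S := by
    have := mul_le_mul_of_nonneg_right (Real.one_sub_le_exp_neg S) (Real.exp_nonneg S)
    rw [← Real.exp_add, neg_add_cancel, Real.exp_zero] at this
    linarith
  calc ‖1 - ∏ j, (1 - x j)‖ ≤ Real.exp S - 1 := by
        rw [norm_sub_rev]
        simpa [sub_eq_add_neg] using Finset.univ.norm_prod_one_add_sub_one_le fun j => -x j
    _ ≤ S * Real.exp S := hexp
    _ ≤ Fintype.card ι * ε * Real.exp (Fintype.card ι) := by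
        gcongr
        · exact hS0.trans hS
        · exact hS.trans (mul_le_of_le_one_right (Nat.cast_nonneg _) hε)
    _ = Fintype.card ι * Real.exp (Fintype.card ι) * ε := by ring

lemma norm_prod_inv_one_sub_le {z : ι → ℂ} {κ : ℝ} (hκ : 0 < κ) (hz : ∀ j, κ ≤ ‖1 - z j‖) :
    ‖∏ j, (1 - z j)⁻¹‖ ≤ κ⁻¹ ^ Fintype.card ι := by
  rw [norm_prod, Fintype.card, ← Finset.prod_const]
  exact Finset.prod_le_prod (fun _ _ => norm_nonneg _) fun j _ =>
    norm_inv (1 - z j) ▸ inv_anti₀ hκ (hz j)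

lemma expKernel_neg (α : ι → ℝ) (u : ℝ) (s : ℂ) :
    expKernel α u (-s) = exp (-(u * s)) * ∏ j, -(exp (-(α j * s)) * (1 - exp (-(α j * s)))⁻¹) := by
  simp only [expKernel, mul_neg, neg_neg]
  congr 1
  refine Finset.prod_congr rfl fun j _ => ?_
  rw [exp_neg, ← mul_inv, ← inv_neg, mul_sub, mul_one, mul_inv_cancel₀ (exp_ne_zero _), neg_sub]

lemma norm_expKernel_neg_le {α : ι → ℝ} {u d κ : ℝ} (hu : 0 ≤ u) (hd : d ≤ ∑ j, α j)
    (hκ : 0 < κ) {s : ℂ} (hs : 0 ≤ s.re) (hsep : ∀ j, κ ≤ ‖1 - exp (-(α j * s))‖) :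
    ‖expKernel α u (-s)‖ ≤ κ⁻¹ ^ Fintype.card ι * Real.exp (-(d * s.re)) := by
  have hdecay : Real.exp (-(u * s.re)) * ∏ j, Real.exp (-(α j * s.re))
      ≤ Real.exp (-(d * s.re)) := by
    rw [← Real.exp_sum, Finset.sum_neg_distrib, ← Finset.sum_mul, ← Real.exp_add, Real.exp_le_exp]
    linarith [mul_nonneg hu hs, mul_le_mul_of_nonneg_right hd hs]
  rw [expKernel_neg, norm_mul, norm_prod, norm_exp_neg_ofReal_mul]
  simp only [norm_neg, norm_mul, norm_exp_neg_ofReal_mul, Finset.prod_mul_distrib]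
  rw [← norm_prod, ← mul_assoc, mul_comm]
  exact mul_le_mul (norm_prod_inv_one_sub_le hκ hsep) hdecay (by positivity) (by positivity)

variable [DecidableEq ι]

/-- The box of lattice points all of whose coordinates are less than `K`. -/
def latticeBox (ι : Type*) [Fintype ι] [DecidableEq ι] (K : ℕ) : Finset (ι → ℕ) :=
  Fintype.piFinset fun _ => Finset.range K

lemma mem_latticeBox {α : ι → ℝ} (hα : ∀ j, 0 < α j) {u : ℝ} {K : ℕ} (hK : ∀ j, u < K * α j)
    {n : ι → ℕ} (hn : linForm α n ≤ u) : n ∈ latticeBox ι K := by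
  refine Fintype.mem_piFinset.2 fun j => Finset.mem_range.2 ?_
  have hle : n j * α j ≤ linForm α n :=
    Finset.single_le_sum (f := fun i => n i * α i)
      (fun i _ => mul_nonneg (Nat.cast_nonneg _) (hα i).le) (Finset.mem_univ j)
  exact_mod_cast lt_of_mul_lt_mul_right ((hle.trans hn).trans_lt (hK j)) (hα j).le

lemma exists_forall_lt_mul {ι : Type*} [Finite ι] {α : ι → ℝ} (hα : ∀ j, 0 < α j) (u : ℝ) :
    ∃ K : ℕ, ∀ j, u < K * α j :=
  (eventually_all.2 fun j => (tendsto_natCast_atTop_atTop.atTop_mul_const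
    (hα j)).eventually_gt_atTop u).exists

lemma halfCount_eq_sum {α : ι → ℝ} (hα : ∀ j, 0 < α j) {u : ℝ} {K : ℕ} (hK : ∀ j, u < K * α j) :
    halfCount α u = ∑ n ∈ latticeBox ι K, halfStep (u - linForm α n) := by
  refine finsum_eq_sum_of_support_subset _ fun n hn => mem_latticeBox hα hK ?_
  contrapose! hn
  exact Function.notMem_support.2 (halfStep_of_neg (sub_neg.2 hn))

/-- The difference between `expKernel α u` and the terms of its expansion with a nonnegative
exponent, a constant term being halved. -/
noncomputable def expRemainder (α : ι → ℝ) (u : ℝ) (K : ℕ) (s : ℂ) : ℂ :=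
  expKernel α u s
    - ∑ n ∈ latticeBox ι K, halfStep (u - linForm α n) * exp ((u - linForm α n : ℝ) * s)

lemma sum_latticeBox_exp {α : ι → ℝ} (u : ℝ) (K : ℕ) {s : ℂ}
    (hs : ∀ j, exp (-(α j * s)) ≠ 1) :
    ∑ n ∈ latticeBox ι K, exp ((u - linForm α n : ℝ) * s)
      = expKernel α u s * ∏ j, (1 - exp (-(α j * s)) ^ K) := by
  have hterm (n : ι → ℕ) :
      exp ((u - linForm α n : ℝ) * s) = exp (u * s) * ∏ j, exp (-(α j * s)) ^ n j := by
    simp_rw [← exp_nat_mul, ← exp_sum, ← exp_add, linForm]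
    push_cast
    simp_rw [sub_mul, Finset.sum_mul, mul_neg, Finset.sum_neg_distrib, ← sub_eq_add_neg, mul_assoc]
  have hgeom (j : ι) : ∑ p ∈ Finset.range K, exp (-(α j * s)) ^ p
      = (1 - exp (-(α j * s)))⁻¹ * (1 - exp (-(α j * s)) ^ K) := by
    rw [← mul_neg_geom_sum, inv_mul_cancel_left₀ (sub_ne_zero.2 (hs j).symm)]
  simp_rw [hterm, ← Finset.mul_sum, latticeBox, ← Finset.prod_univ_sum, hgeom,
    Finset.prod_mul_distrib, expKernel, mul_assoc]

lemma norm_expKernel_sub_sum_le {α : ι → ℝ} {u d κ : ℝ} {K : ℕ}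
    (hd : ∀ j, d + u ≤ K * α j) (hdu : 0 ≤ d + u) (hκ : 0 < κ) {s : ℂ} (hs : 0 ≤ s.re)
    (hsep : ∀ j, κ ≤ ‖1 - exp (-(α j * s))‖) :
    ‖expKernel α u s - ∑ n ∈ latticeBox ι K, exp ((u - linForm α n : ℝ) * s)‖
      ≤ κ⁻¹ ^ Fintype.card ι * (Fintype.card ι * Real.exp (Fintype.card ι))
        * Real.exp (-(d * s.re)) := by
  have hne (j : ι) : exp (-(α j * s)) ≠ 1 := fun h => by
    simpa [h, hκ.not_ge] using hsep j
  have htail : ‖1 - ∏ j, (1 - exp (-(α j * s)) ^ K)‖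
      ≤ Fintype.card ι * Real.exp (Fintype.card ι) * Real.exp (-((d + u) * s.re)) := by
    refine norm_one_sub_prod_one_sub_le (Real.exp_le_one_iff.2 ?_) fun j => ?_
    · exact neg_nonpos.2 (mul_nonneg hdu hs)
    · rw [norm_pow, norm_exp_neg_ofReal_mul, ← Real.exp_nat_mul, mul_neg, ← mul_assoc]
      exact Real.exp_le_exp.2 (neg_le_neg (mul_le_mul_of_nonneg_right (hd j) hs))
  have hsplit : Real.exp (-(d * s.re)) = Real.exp (u * s.re) * Real.exp (-((d + u) * s.re)) := by
    rw [← Real.exp_add]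
    ring_nf
  rw [sum_latticeBox_exp u K hne, ← mul_one_sub, norm_mul, expKernel, norm_mul,
    norm_exp_ofReal_mul, hsplit]
  calc _ ≤ Real.exp (u * s.re) * κ⁻¹ ^ Fintype.card ι * (Fintype.card ι
          * Real.exp (Fintype.card ι) * Real.exp (-((d + u) * s.re))) := by
        gcongr
        exact norm_prod_inv_one_sub_le hκ hsep
    _ = _ := by ring

lemma norm_expRemainder_add_neg_le {α : ι → ℝ} {u d κ : ℝ} {K : ℕ}
    (hu : 0 ≤ u) (hd : 0 ≤ d)
    (hgap : ∀ n ∈ latticeBox ι K, u - linForm α n ≠ 0 → d ≤ |u - linForm α n|)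
    (hbox : ∀ j, d + u ≤ K * α j) (hsum : d ≤ ∑ j, α j) (hκ : 0 < κ) {s : ℂ} (hs : 0 ≤ s.re)
    (hsep : ∀ j, κ ≤ ‖1 - exp (-(α j * s))‖) :
    ‖expRemainder α u K s + expRemainder α u K (-s)‖
      ≤ (κ⁻¹ ^ Fintype.card ι * (Fintype.card ι * Real.exp (Fintype.card ι))
          + κ⁻¹ ^ Fintype.card ι + (latticeBox ι K).card) * Real.exp (-(d * s.re)) := by
  have hsplit : expRemainder α u K s + expRemainder α u K (-s)
      = (expKernel α u s - ∑ n ∈ latticeBox ι K, exp ((u - linForm α n : ℝ) * s))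
        + expKernel α u (-s)
        + ∑ n ∈ latticeBox ι K, (halfStep (-(u - linForm α n)) * exp ((u - linForm α n : ℝ) * s)
          - halfStep (u - linForm α n) * exp (-((u - linForm α n : ℝ) * s))) := by
    simp only [expRemainder, halfStep_neg, mul_neg, ofReal_sub (1 : ℝ), ofReal_one, sub_mul,
      one_mul, Finset.sum_sub_distrib]
    ring
  have hterms := norm_sum_le_of_le (latticeBox ι K) fun n hn =>
    norm_halfStep_exp_sub_le (hgap n hn) hs
  rw [Finset.sum_const, nsmul_eq_mul] at hterms
  rw [hsplit, add_mul, add_mul]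
  exact norm_add₃_le.trans (add_le_add_three
    (norm_expKernel_sub_sum_le hbox (add_nonneg hd hu) hκ hs hsep)
    (norm_expKernel_neg_le hu hsum hκ hs hsep) hterms)

lemma exists_decayRate [Nonempty ι] {α : ι → ℝ} (hα : ∀ j, 0 < α j) {u : ℝ} {K : ℕ}
    (hK : ∀ j, u < K * α j) :
    ∃ d > 0, (∀ n ∈ latticeBox ι K, u - linForm α n ≠ 0 → d ≤ |u - linForm α n|) ∧
      (∀ j, d + u ≤ K * α j) ∧ d ≤ ∑ j, α j := by
  have hsmall {c : ℝ} (hc : 0 < c) : ∀ᶠ d in 𝓝[>] (0 : ℝ), d ≤ c :=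
    (eventually_le_nhds hc).filter_mono nhdsWithin_le_nhds
  have hgap : ∀ᶠ d in 𝓝[>] (0 : ℝ),
      ∀ n ∈ latticeBox ι K, u - linForm α n ≠ 0 → d ≤ |u - linForm α n| :=
    (eventually_all_finset _).2 fun n _ => eventually_imp_distrib_left.2 fun h =>
      hsmall (abs_pos.2 h)
  have hbox : ∀ᶠ d in 𝓝[>] (0 : ℝ), ∀ j, d + u ≤ K * α j :=
    eventually_all.2 fun j => (hsmall (sub_pos.2 (hK j))).mono fun d => le_sub_iff_add_le.1
  have hsum : 0 < ∑ j, α j := Finset.sum_pos (fun j _ => hα j) Finset.univ_nonempty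
  exact (eventually_mem_nhdsWithin.and (hgap.and (hbox.and (hsmall hsum)))).exists

end Lattice

section TaylorExpansion

open Complex
open PowerSeries hiding exp
open scoped PowerSeries

/-- `f` has the asymptotic expansion `φ` at `0`, to all orders; the value of `f` at `0` itself is
irrelevant. -/
def HasTaylorExpansion (f : ℂ → ℂ) (φ : ℝ⟦X⟧) : Prop :=
  ∀ n, (fun s => f s - Polynomial.aeval s (φ.trunc n)) =O[𝓝[≠] 0] fun s => s ^ n

lemma aeval_isBigO_pow {p : Polynomial ℝ} {n : ℕ} (h : Polynomial.X ^ n ∣ p) :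
    (fun s : ℂ => Polynomial.aeval s p) =O[𝓝[≠] 0] fun s => s ^ n := by
  obtain ⟨q, rfl⟩ := h
  simpa using (Asymptotics.isBigO_refl (fun s : ℂ => s ^ n) _).mul
    (isBigO_one_of_continuousAt (Polynomial.continuous_aeval q).continuousAt)

lemma X_pow_dvd_sub_trunc (φ : ℝ⟦X⟧) (n : ℕ) : X ^ n ∣ φ - (φ.trunc n : ℝ⟦X⟧) :=
  X_pow_dvd_iff.2 fun m hm => by simp [coeff_trunc, hm]

namespace HasTaylorExpansion

variable {f g : ℂ → ℂ} {φ ψ : ℝ⟦X⟧}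

lemma isBigO_one (hf : HasTaylorExpansion f φ) : f =O[𝓝[≠] 0] fun _ => (1 : ℂ) := by
  simpa using hf 0

lemma isBigO_pow (hf : HasTaylorExpansion f φ) {n : ℕ} (h : X ^ n ∣ φ) :
    f =O[𝓝[≠] 0] fun s => s ^ n := by
  obtain ⟨ψ, rfl⟩ := h
  simpa only [trunc_X_pow_self_mul, map_zero, sub_zero] using hf n

lemma congr (hf : HasTaylorExpansion f φ) (h : f =ᶠ[𝓝[≠] 0] g) : HasTaylorExpansion g φ :=
  fun n => (hf n).congr' (h.sub .rfl) .rfl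

lemma aeval (p : Polynomial ℝ) : HasTaylorExpansion (fun s => Polynomial.aeval s p) p := fun n => by
  simp only [← map_sub]
  refine aeval_isBigO_pow (Polynomial.X_pow_dvd_iff.2 fun m hm => ?_)
  simp [coeff_trunc, hm]

lemma one : HasTaylorExpansion (fun _ => 1) 1 := by
  simpa using aeval 1

lemma sub (hf : HasTaylorExpansion f φ) (hg : HasTaylorExpansion g ψ) :
    HasTaylorExpansion (fun s => f s - g s) (φ - ψ) := fun n =>
  ((hf n).sub (hg n)).congr_left fun s => by simp only [map_sub]; ring

lemma mul (hf : HasTaylorExpansion f φ) (hg : HasTaylorExpansion g ψ) :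
    HasTaylorExpansion (fun s => f s * g s) (φ * ψ) := fun n => by
  have hp := aeval (φ.trunc n * ψ.trunc n) n
  rw [Polynomial.coe_mul, trunc_trunc_mul_trunc] at hp
  have hfg := (hf n).mul hg.isBigO_one
  have hgf := (isBigO_one_of_continuousAt
    (Polynomial.continuous_aeval (φ.trunc n)).continuousAt).mul (hg n)
  simp only [mul_one, one_mul] at hfg hgf
  refine ((hfg.add hgf).add hp).congr_left fun s => ?_
  simp only [map_mul]
  ring

lemma prod {κ : Type*} (S : Finset κ) {f : κ → ℂ → ℂ} {φ : κ → ℝ⟦X⟧}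
    (h : ∀ i ∈ S, HasTaylorExpansion (f i) (φ i)) :
    HasTaylorExpansion (fun s => ∏ i ∈ S, f i s) (∏ i ∈ S, φ i) := by
  classical
  induction S using Finset.induction_on with
  | empty => simpa using one
  | insert i S hi ih =>
    simp only [Finset.prod_insert hi]
    exact (h i (Finset.mem_insert_self i S)).mul
      (ih fun j hj => h j (Finset.mem_insert_of_mem hj))

lemma of_mul_left (hf : HasTaylorExpansion f φ) (hφ : X ∣ φ)
    (hinv : (fun s => s) =O[𝓝[≠] 0] f)
    (hfg : HasTaylorExpansion (fun s => f s * g s) (φ * ψ)) : HasTaylorExpansion g ψ := fun n => by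
  have hdvd : X ^ (n + 1) ∣ φ * ψ - φ * (ψ.trunc n : ℝ⟦X⟧) := by
    rw [pow_succ', ← mul_sub]
    exact mul_dvd_mul hφ (X_pow_dvd_sub_trunc ψ n)
  have hmul := (hinv.mul (Asymptotics.isBigO_refl
    (fun s => g s - Polynomial.aeval s (ψ.trunc n)) _)).trans
      (((hfg.sub (hf.mul (aeval (ψ.trunc n)))).isBigO_pow hdvd).congr_left fun s =>
        (mul_sub _ _ _).symm)
  refine ((Asymptotics.isBigO_refl (fun s : ℂ => s⁻¹) _).mul hmul).congr' ?_ ?_ <;>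
    filter_upwards [self_mem_nhdsWithin] with s hs
  · exact inv_mul_cancel_left₀ hs _
  · rw [pow_succ', inv_mul_cancel_left₀ hs]

end HasTaylorExpansion

lemma hasTaylorExpansion_exp (a : ℝ) :
    HasTaylorExpansion (fun s => exp (a * s)) (rescale a (PowerSeries.exp ℝ)) := fun n => by
  have hlim : Tendsto (fun s : ℂ => a * s) (𝓝[≠] 0) (𝓝 0) := by
    simpa using (continuous_const_mul (a : ℂ)).continuousWithinAt (x := 0) |>.tendsto
  have hexp := (exp_sub_sum_range_isBigO_pow n).comp_tendsto hlim
  simp only [Function.comp_def, mul_pow] at hexp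
  refine (hexp.trans ((Asymptotics.isBigO_refl _ _).const_mul_left _)).congr_left fun s => ?_
  simp only [trunc_apply, ← Finset.range_eq_Ico, map_sum, Polynomial.aeval_monomial, coeff_rescale,
    coeff_exp, sub_right_inj]
  refine Finset.sum_congr rfl fun m _ => ?_
  simp
  ring

lemma hasTaylorExpansion_mul_inv_one_sub_exp {a : ℝ} (ha : a ≠ 0) :
    HasTaylorExpansion (fun s => s * (1 - exp (-(a * s)))⁻¹)
      (C a⁻¹ * rescale a (bernoulli'PowerSeries ℝ)) := by
  set E : ℝ⟦X⟧ := rescale a (PowerSeries.exp ℝ)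
  have hE := hasTaylorExpansion_exp a
  have hX : X ∣ E - 1 := X_dvd_iff.2 (by
    rw [← coeff_zero_eq_constantCoeff_apply, map_sub, coeff_rescale]
    simp)
  have hinv : (fun s : ℂ => s) =O[𝓝[≠] 0] fun s => exp (a * s) - 1 := by
    have hder : HasDerivAt (fun s : ℂ => exp (a * s)) a 0 := by
      simpa using ((hasDerivAt_id (0 : ℂ)).const_mul (a : ℂ)).cexp
    have hpair : Tendsto (fun s : ℂ => (s, (0 : ℂ))) (𝓝[≠] 0) (𝓝 0 ×ˢ pure 0) :=
      tendsto_nhdsWithin_of_tendsto_nhds tendsto_id |>.prodMk tendsto_const_pure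
    simpa [Function.comp_def] using
      (hder.isTheta_sub (ofReal_ne_zero.2 ha)).isBigO_symm.comp_tendsto hpair
  have hseries : (E - 1) * (C a⁻¹ * rescale a (bernoulli'PowerSeries ℝ))
      = ((Polynomial.X : Polynomial ℝ) : ℝ⟦X⟧) * E := by
    have h := congr_arg (rescale a) (bernoulli'PowerSeries_mul_exp_sub_one ℝ)
    simp only [map_mul, map_sub, map_one, rescale_X] at h
    rw [mul_left_comm, mul_comm (E - 1), h, ← mul_assoc, ← mul_assoc, ← map_mul,
      inv_mul_cancel₀ ha, map_one, one_mul, Polynomial.coe_X]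
  refine (hE.sub .one).of_mul_left hX hinv
    (hseries ▸ ((HasTaylorExpansion.aeval _).mul hE).congr ?_)
  filter_upwards [hinv.eq_zero_imp, self_mem_nhdsWithin] with s hs hs0
  have hne : exp (a * s) - 1 ≠ 0 := fun h => hs0 (hs h)
  have hinv_eq : (1 - exp (-(a * s)))⁻¹ = exp (a * s) * (exp (a * s) - 1)⁻¹ := by
    rw [← inv_inj, mul_inv, inv_inv, inv_inv, ← exp_neg, mul_sub, ← exp_add, neg_add_cancel,
      exp_zero, mul_one]
  rw [Polynomial.aeval_X, hinv_eq, mul_comm (exp (a * s) - 1), mul_assoc, mul_assoc,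
    inv_mul_cancel₀ hne, mul_one]

/-- The Taylor series at `0` of `e ^ (u s) * ∏ j, s / (1 - e ^ (-α j s))`. -/
noncomputable def kernelSeries {ι : Type*} [Fintype ι] (α : ι → ℝ) (u : ℝ) : ℝ⟦X⟧ :=
  rescale u (PowerSeries.exp ℝ) * ∏ j, C (α j)⁻¹ * rescale (α j) (bernoulli'PowerSeries ℝ)

lemma hasTaylorExpansion_kernel {ι : Type*} [Fintype ι] {α : ι → ℝ} (hα : ∀ j, α j ≠ 0) (u : ℝ) :
    HasTaylorExpansion (fun s => s ^ Fintype.card ι * expKernel α u s) (kernelSeries α u) := by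
  refine ((hasTaylorExpansion_exp u).mul (.prod Finset.univ fun j _ =>
    hasTaylorExpansion_mul_inv_one_sub_exp (hα j))).congr (.of_forall fun s => ?_)
  simp only [expKernel, Finset.prod_mul_distrib, Finset.prod_const, Finset.card_univ]
  ring

/-- The residue at `0` of `expKernel α u s / s`, a polynomial in `u` of degree `card ι`. -/
noncomputable def polyPart {ι : Type*} [Fintype ι] (α : ι → ℝ) (u : ℝ) : ℝ :=
  coeff (Fintype.card ι) (kernelSeries α u)

lemma polyPart_one {α : Fin 1 → ℝ} (hα : α 0 ≠ 0) (u : ℝ) : polyPart α u = u / α 0 + 1 / 2 := by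
  simp [polyPart, kernelSeries, bernoulli'PowerSeries, coeff_mul, Finset.Nat.antidiagonal_succ,
    coeff_rescale]
  field_simp
  ring

lemma polyPart_log_three {a : Fin 3 → ℕ} (ha : ∀ j, Real.log (a j) ≠ 0) (x : ℝ) :
    polyPart (fun j => Real.log (a j)) (Real.log x) = cubicPart (a 0) (a 1) (a 2) x := by
  have h0 := ha 0
  have h1 := ha 1
  have h2 := ha 2
  simp [polyPart, kernelSeries, bernoulli'PowerSeries, coeff_mul, Finset.Nat.antidiagonal_succ,
    coeff_rescale, Fin.prod_univ_three, cubicPart, Nat.factorial]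
  field_simp
  ring

end TaylorExpansion

section Separation

open Complex Set

variable {ι : Type*}

/-- The real numbers `R` such that every `R * α j` has distance at least `δ` from the integers. -/
def separatedSet (α : ι → ℝ) (δ : ℝ) : Set ℝ := {R | ∀ j, ∀ m : ℤ, δ ≤ |R * α j - m|}

/-- `R → ∞` through the elements of `separatedSet α δ`. -/
def separatedFilter (α : ι → ℝ) (δ : ℝ) : Filter ℝ := atTop ⊓ 𝓟 (separatedSet α δ)

lemma separatedFilter_le_comp {κ : Type*} (α : ι → ℝ) (δ : ℝ) (f : κ → ι) :
    separatedFilter α δ ≤ separatedFilter (α ∘ f) δ :=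
  inf_le_inf_left _ (principal_mono.2 fun _ hR j => hR (f j))

/-- The upper right corner of the rectangle of integration. Its height `2πR` keeps the horizontal
sides away from the poles when `R ∈ separatedSet α δ`; its width is the square root of its height,
so that the integral is small on all four sides. -/
noncomputable def rectCorner (R : ℝ) : ℂ :=
  (√(2 * Real.pi * R) : ℝ) + (2 * Real.pi * R : ℝ) * I

lemma rectCorner_re (R : ℝ) : (rectCorner R).re = √(2 * Real.pi * R) := by
  simp [rectCorner]

lemma rectCorner_im (R : ℝ) : (rectCorner R).im = 2 * Real.pi * R := by
  rw [rectCorner, add_im, ofReal_im, im_ofReal_mul, I_im, zero_add, mul_one]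

lemma one_le_rectCorner_re {R : ℝ} (hR : 1 ≤ R) : 1 ≤ (rectCorner R).re := by
  rw [rectCorner_re, Real.one_le_sqrt]
  nlinarith [Real.two_le_pi]

lemma tendsto_rectCorner_re : Tendsto (fun R => (rectCorner R).re) atTop atTop := by
  simp only [rectCorner_re]
  exact Real.tendsto_sqrt_atTop.comp (tendsto_id.const_mul_atTop Real.two_pi_pos)

lemma two_mul_le_abs_sin_pi_mul {δ y : ℝ} (hy : ∀ m : ℤ, δ ≤ |y - m|) :
    2 * δ ≤ |Real.sin (Real.pi * y)| := by
  have habs (t : ℝ) : |Real.pi * t| = Real.pi * |t| := by rw [abs_mul, abs_of_pos Real.pi_pos]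
  have hround : |Real.sin (Real.pi * (y - round y))| = |Real.sin (Real.pi * y)| := by
    rw [mul_sub, mul_comm Real.pi (round y : ℝ), Real.sin_sub_int_mul_pi, abs_mul, abs_zpow,
      abs_neg, abs_one, one_zpow, one_mul]
  have hle : |Real.pi * (y - round y)| ≤ Real.pi / 2 := by
    rw [habs]
    nlinarith [abs_sub_round y, Real.pi_pos]
  calc 2 * δ ≤ 2 * |y - round y| := by linarith [hy (round y)]
    _ = 2 / Real.pi * |Real.pi * (y - round y)| := by
        rw [habs, ← mul_assoc, div_mul_cancel₀ _ Real.pi_ne_zero]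
    _ ≤ _ := hround ▸ Real.mul_abs_le_abs_sin hle

lemma abs_sin_half_im_le_norm_one_sub_exp (w : ℂ) :
    |Real.sin (w.im / 2)| ≤ ‖1 - exp w‖ := by
  have hcos : Real.cos w.im = 1 - 2 * Real.sin (w.im / 2) ^ 2 := by
    have := Real.cos_two_mul (w.im / 2)
    rw [mul_div_cancel₀ _ two_ne_zero, Real.cos_sq'] at this
    linarith
  have hnorm : ‖1 - exp w‖ ^ 2 = (1 - Real.exp w.re) ^ 2
      + 4 * Real.exp w.re * Real.sin (w.im / 2) ^ 2 := by
    rw [Complex.sq_norm, normSq_apply, sub_re, sub_im, one_re, one_im, exp_re, exp_im]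
    linear_combination Real.exp w.re ^ 2 * Real.sin_sq_add_cos_sq w.im - 2 * Real.exp w.re * hcos
  refine abs_le_of_sq_le_sq ?_ (norm_nonneg _)
  rw [hnorm]
  have hconvex : (1 - Real.exp w.re) ^ 2 + 4 * Real.exp w.re * Real.sin (w.im / 2) ^ 2
      - Real.sin (w.im / 2) ^ 2 = Real.cos (w.im / 2) ^ 2 * (1 - Real.exp w.re) ^ 2
        + Real.sin (w.im / 2) ^ 2 * (2 * Real.exp w.re + Real.exp w.re ^ 2) := by
    rw [Real.cos_sq']
    ring
  have : 0 ≤ 2 * Real.exp w.re + Real.exp w.re ^ 2 := by positivity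
  nlinarith [mul_nonneg (sq_nonneg (Real.sin (w.im / 2))) this,
    mul_nonneg (sq_nonneg (Real.cos (w.im / 2))) (sq_nonneg (1 - Real.exp w.re))]

lemma one_sub_exp_neg_le_norm_one_sub_exp_neg {a : ℝ} {w : ℂ} (hw : a ≤ w.re) :
    1 - Real.exp (-a) ≤ ‖1 - exp (-w)‖ := by
  have hexp : ‖exp (-w)‖ ≤ Real.exp (-a) := by
    rw [norm_exp, neg_re]
    gcongr
  have := norm_sub_norm_le 1 (exp (-w))
  rw [norm_one] at this
  linarith

lemma exists_le_norm_one_sub_exp [Finite ι] {α : ι → ℝ} (hα : ∀ j, 0 < α j) {δ : ℝ} (hδ : 0 < δ) :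
    ∃ κ > 0, ∀ R ∈ separatedSet α δ, 1 ≤ R →
      ∀ s ∈ rectBoundary (-rectCorner R) (rectCorner R), 0 ≤ s.re →
        ∀ j, κ ≤ ‖1 - exp (-(α j * s))‖ := by
  have hsmall {c : ℝ} (hc : 0 < c) : ∀ᶠ κ in 𝓝[>] (0 : ℝ), κ ≤ c :=
    (eventually_le_nhds hc).filter_mono nhdsWithin_le_nhds
  obtain ⟨κ, hκ, hκδ, hκα⟩ := (eventually_mem_nhdsWithin.and ((hsmall (mul_pos two_pos hδ)).and
    (eventually_all.2 fun j => hsmall (sub_pos.2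
      (Real.exp_zero ▸ Real.exp_lt_exp.2 (neg_neg_of_pos (hα j))))))).exists
  refine ⟨κ, hκ, fun R hR hR1 s hs hre j => ?_⟩
  have hM := one_le_rectCorner_re hR1
  simp only [mem_rectBoundary, neg_re, neg_im] at hs
  rcases hs with ⟨-, him⟩ | ⟨hre', -⟩
  · have hsin : |Real.sin ((-(α j * s)).im / 2)| = |Real.sin (Real.pi * (R * α j))| := by
      rw [neg_im, im_ofReal_mul]
      rcases him with him | him <;> rw [him, rectCorner_im]
      · ring_nf
      · rw [← abs_neg, ← Real.sin_neg]
        ring_nf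
    exact (hκδ.trans (two_mul_le_abs_sin_pi_mul (hR j))).trans
      (hsin ▸ abs_sin_half_im_le_norm_one_sub_exp _)
  · refine (hκα j).trans (one_sub_exp_neg_le_norm_one_sub_exp_neg ?_)
    rw [re_ofReal_mul]
    exact le_mul_of_one_le_right (hα j).le (by rcases hre' with h | h <;> linarith)

variable [Fintype ι] [DecidableEq ι]

lemma analyticAt_expRemainder {α : ι → ℝ} (u : ℝ) (K : ℕ) {s : ℂ}
    (h : ∀ j, exp (-(α j * s)) ≠ 1) : AnalyticAt ℂ (expRemainder α u K) s := by
  unfold expRemainder expKernel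
  refine .sub (.mul (by fun_prop) (Finset.analyticAt_fun_prod _ fun j _ => .inv (by fun_prop) ?_))
    (Finset.analyticAt_fun_sum _ fun n _ => by fun_prop)
  exact sub_ne_zero.2 (h j).symm

lemma exists_norm_expRemainder_add_neg_le [Nonempty ι] {α : ι → ℝ} (hα : ∀ j, 0 < α j) {u : ℝ}
    (hu : 0 ≤ u) {K : ℕ} (hK : ∀ j, u < K * α j) {δ : ℝ} (hδ : 0 < δ) :
    ∃ C d, 0 < d ∧ ∀ R ∈ separatedSet α δ, 1 ≤ R →
      ContinuousOn (expRemainder α u K) (rectBoundary (-rectCorner R) (rectCorner R)) ∧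
      ∀ s ∈ rectBoundary (-rectCorner R) (rectCorner R),
        ‖expRemainder α u K s + expRemainder α u K (-s)‖ ≤ C * Real.exp (-(d * |s.re|)) := by
  obtain ⟨κ, hκ, hsep⟩ := exists_le_norm_one_sub_exp hα hδ
  obtain ⟨d, hd, hgap, hbox, hsum⟩ := exists_decayRate hα hK
  refine ⟨κ⁻¹ ^ Fintype.card ι * (Fintype.card ι * Real.exp (Fintype.card ι))
    + κ⁻¹ ^ Fintype.card ι + (latticeBox ι K).card, d, hd,
    fun R hR hR1 => ⟨fun s hs => ?_, fun s hs => ?_⟩⟩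
  · refine (analyticAt_expRemainder u K fun j h => ?_).continuousAt.continuousWithinAt
    rcases le_total 0 s.re with hre | hre
    · exact hκ.not_ge (by simpa [h] using hsep R hR hR1 s hs hre j)
    · have h' : exp (-(α j * -s)) = 1 := by
        rwa [mul_neg, exp_neg, inv_eq_one]
      have := hsep R hR hR1 (-s) (neg_mem_rectBoundary hs) (by simpa using hre) j
      rw [h', sub_self, norm_zero] at this
      exact hκ.not_ge this
  · wlog hre : 0 ≤ s.re generalizing s
    · have := this (-s) (neg_mem_rectBoundary hs) (by simpa using (not_le.1 hre).le)
      rwa [neg_neg, add_comm, neg_re, abs_neg] at this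
    · rw [abs_of_nonneg hre]
      exact norm_expRemainder_add_neg_le hu hd.le hgap hbox hsum hκ hre (hsep R hR hR1 s hs hre)

lemma tendsto_rectIntegral_expRemainder_div [Nonempty ι] {α : ι → ℝ} (hα : ∀ j, 0 < α j) {u : ℝ}
    (hu : 0 ≤ u) {K : ℕ} (hK : ∀ j, u < K * α j) {δ : ℝ} (hδ : 0 < δ) :
    Tendsto (fun R => rectIntegral (fun s => expRemainder α u K s / s) (-rectCorner R)
      (rectCorner R)) (separatedFilter α δ) (𝓝 0) := by
  obtain ⟨C, d, hd, hbound⟩ := exists_norm_expRemainder_add_neg_le hα hu hK hδ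
  have hlim : Tendsto (fun M : ℝ => 2 * C * M⁻¹ + 2 * C * (M * Real.exp (-d * M))) atTop (𝓝 0) := by
    have hexp := tendsto_rpow_mul_exp_neg_mul_atTop_nhds_zero 1 d hd
    simp only [Real.rpow_one] at hexp
    simpa using (tendsto_inv_atTop_zero.const_mul (2 * C)).add (hexp.const_mul (2 * C))
  refine squeeze_zero_norm' ?_ ((hlim.comp tendsto_rectCorner_re).mono_left inf_le_left)
  filter_upwards [mem_inf_of_right (mem_principal_self _), mem_inf_of_left (eventually_ge_atTop 1)]
    with R hR hR1
  obtain ⟨hcont, hle⟩ := hbound R hR hR1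
  have hM : 0 < (rectCorner R).re := by linarith [one_le_rectCorner_re hR1]
  have hT : (rectCorner R).im = (rectCorner R).re ^ 2 := by
    rw [rectCorner_re, rectCorner_im, Real.sq_sqrt (by positivity)]
  have hC : 0 ≤ C := by
    have := (norm_nonneg _).trans (hle _ (mem_rectBoundary.2 (.inr ⟨.inr rfl, right_mem_uIcc⟩)))
    exact nonneg_of_mul_nonneg_left this (Real.exp_pos _)
  have hint := norm_rectIntegral_div_le hM (hT ▸ pow_pos hM 2) hcont
    (fun s hs => (hle s hs).trans (mul_le_of_le_one_right hC (Real.exp_le_one_iff.2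
      (neg_nonpos.2 (mul_nonneg hd.le (abs_nonneg _))))))
    fun s hs hre => by simpa only [hre, abs_of_pos hM] using hle s hs
  refine hint.trans_eq ?_
  rw [hT, Function.comp_apply, neg_mul]
  field_simp

end Separation

section Residues

open Complex Set

lemma div_sub_inv_sub_isBigO_one {E q : ℂ → ℂ} {p : ℂ} (hE : AnalyticAt ℂ E p)
    (hq : AnalyticAt ℂ q p) (hq0 : q p = 0) (hq' : deriv q p ≠ 0) :
    (fun z => E z / q z - E p / deriv q p * (z - p)⁻¹) =O[𝓝[≠] p] fun _ => (1 : ℂ) := by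
  have hdslope {g : ℂ → ℂ} (hg : AnalyticAt ℂ g p) : AnalyticAt ℂ (dslope g p) p := by
    obtain ⟨r, hr⟩ := hg
    exact ⟨_, hr.has_fpower_series_dslope_fslope⟩
  have hdiv : AnalyticAt ℂ (fun z => E z / dslope q p z) p :=
    hE.div (hdslope hq) (by rwa [dslope_same])
  refine (isBigO_one_of_continuousAt (hdslope hdiv).continuousAt).congr' ?_ .rfl
  filter_upwards [self_mem_nhdsWithin] with z hz
  have hz' : z - p ≠ 0 := sub_ne_zero.2 hz
  rw [dslope_of_ne _ hz, slope_def_field, dslope_same, dslope_of_ne _ hz, slope_def_field, hq0,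
    sub_zero, div_div_eq_mul_div, sub_div, mul_div_right_comm,
    mul_div_cancel_right₀ _ hz', div_eq_mul_inv (E p / _)]

variable {ι : Type*}

/-- The zero `2πik / α j` of `1 - e ^ (-α j s)`. -/
noncomputable def expPole (α : ι → ℝ) (j : ι) (k : ℤ) : ℂ := 2 * Real.pi * I * k / α j

lemma expPole_eq_ofReal_mul_I (α : ι → ℝ) (j : ι) (k : ℤ) :
    expPole α j k = (2 * Real.pi * k / α j : ℝ) * I := by
  rw [expPole]
  push_cast
  ring

lemma expPole_re (α : ι → ℝ) (j : ι) (k : ℤ) : (expPole α j k).re = 0 := by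
  rw [expPole_eq_ofReal_mul_I, re_ofReal_mul, I_re, mul_zero]

lemma expPole_im (α : ι → ℝ) (j : ι) (k : ℤ) : (expPole α j k).im = 2 * Real.pi * k / α j := by
  rw [expPole_eq_ofReal_mul_I, im_ofReal_mul, I_im, mul_one]

lemma expPole_ne_zero {α : ι → ℝ} {j : ι} (hα : α j ≠ 0) {k : ℤ} (hk : k ≠ 0) :
    expPole α j k ≠ 0 :=
  div_ne_zero (mul_ne_zero two_pi_I_ne_zero (Int.cast_ne_zero.2 hk)) (ofReal_ne_zero.2 hα)

lemma exp_neg_mul_eq_one_iff {α : ι → ℝ} {j : ι} (hα : α j ≠ 0) {s : ℂ} :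
    exp (-(α j * s)) = 1 ↔ ∃ k, s = expPole α j k := by
  rw [exp_neg, inv_eq_one, exp_eq_one_iff]
  refine exists_congr fun k => ?_
  rw [expPole, eq_div_iff (ofReal_ne_zero.2 hα), mul_comm s, mul_comm (k : ℂ)]

lemma eq_of_expPole_eq {α : ι → ℝ} (hα : ∀ j, α j ≠ 0)
    (hirr : Pairwise fun i j => Irrational (α i / α j)) {i j : ι} {k m : ℤ} (hk : k ≠ 0)
    (h : expPole α i k = expPole α j m) : i = j ∧ k = m := by
  have hreal : (k : ℝ) * α j = m * α i := by
    rw [expPole, expPole, div_eq_div_iff (ofReal_ne_zero.2 (hα i)) (ofReal_ne_zero.2 (hα j)),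
      mul_assoc (2 * Real.pi * I), mul_assoc (2 * Real.pi * I),
      mul_right_inj' two_pi_I_ne_zero] at h
    exact_mod_cast h
  obtain rfl : i = j := by
    by_contra hij
    refine (hirr (Ne.symm hij)).ne_rat (m / k : ℚ) ?_
    have : (k : ℝ) ≠ 0 := Int.cast_ne_zero.2 hk
    have := hα i
    push_cast
    rw [div_eq_div_iff ‹_› ‹_›, ← hreal, mul_comm]
  exact ⟨rfl, by exact_mod_cast mul_right_cancel₀ (hα i) hreal⟩

lemma abs_expPole_im_le_iff {α : ι → ℝ} {j : ι} (hα : 0 < α j) {k : ℤ} {R : ℝ} :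
    |(expPole α j k).im| ≤ 2 * Real.pi * R ↔ |(k : ℝ)| ≤ R * α j := by
  rw [expPole_im, abs_div, abs_of_pos hα, div_le_iff₀ hα, abs_mul, abs_of_pos Real.two_pi_pos,
    mul_assoc (2 * Real.pi), mul_le_mul_iff_right₀ Real.two_pi_pos]

variable [Fintype ι]

/-- The nonzero poles `expPole α j k` of height at most `2πR`, as pairs of `j` and `k`. -/
noncomputable def poleIndex (α : ι → ℝ) (R : ℝ) : Finset (Σ _ : ι, ℤ) :=
  Finset.univ.sigma fun j => (Finset.Icc (-(⌊R * α j⌋₊ : ℤ)) ⌊R * α j⌋₊).erase 0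

lemma mem_poleIndex {α : ι → ℝ} (hα : ∀ j, 0 ≤ α j) {R : ℝ} (hR : 0 ≤ R) {x : Σ _ : ι, ℤ} :
    x ∈ poleIndex α R ↔ x.2 ≠ 0 ∧ |(x.2 : ℝ)| ≤ R * α x.1 := by
  rw [← Int.cast_abs, Int.abs_eq_natAbs, Int.cast_natCast,
    ← Nat.le_floor_iff (mul_nonneg hR (hα _))]
  simp only [poleIndex, Finset.mem_sigma, Finset.mem_univ, true_and, Finset.mem_erase,
    Finset.mem_Icc]
  omega

lemma expPole_mem_rect {α : ι → ℝ} (hα : ∀ j, 0 < α j) {δ : ℝ} (hδ : 0 < δ) {R : ℝ} (hR : 0 < R)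
    (hsep : R ∈ separatedSet α δ) {x : Σ _ : ι, ℤ} (hx : x ∈ poleIndex α R) :
    expPole α x.1 x.2 ∈ Ioo (-rectCorner R).re (rectCorner R).re ×ℂ
      Ioo (-rectCorner R).im (rectCorner R).im := by
  obtain ⟨-, hle⟩ := (mem_poleIndex (fun j => (hα j).le) hR.le).1 hx
  have hlt : |(x.2 : ℝ)| < R * α x.1 := by
    refine hle.lt_of_ne fun h => hδ.not_ge ?_
    simpa [← h] using hsep x.1 |x.2|
  have him : |(expPole α x.1 x.2).im| < 2 * Real.pi * R := by
    rw [expPole_im, abs_div, abs_of_pos (hα _), div_lt_iff₀ (hα _), abs_mul,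
      abs_of_pos Real.two_pi_pos, mul_assoc (2 * Real.pi)]
    gcongr
  rw [mem_reProdIm, expPole_re, neg_re, neg_im, rectCorner_re, rectCorner_im]
  exact ⟨⟨neg_neg_of_pos (by positivity), by positivity⟩, abs_lt.1 him⟩

variable [DecidableEq ι]

/-- The residue of `expKernel α u s / s` at `expPole α j k`, for `k ≠ 0`. -/
noncomputable def expResidue (α : ι → ℝ) (u : ℝ) (j : ι) (k : ℤ) : ℂ :=
  exp (u * expPole α j k) / expPole α j k
    * (∏ i ∈ Finset.univ.erase j, (1 - exp (-(α i * expPole α j k)))⁻¹) / α j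

/-- The sum of the residues of `expKernel α u s / s` at the nonzero poles of height at most
`2πR`. -/
noncomputable def residueSum (α : ι → ℝ) (u R : ℝ) : ℂ :=
  ∑ x ∈ poleIndex α R, expResidue α u x.1 x.2

lemma meromorphicAt_expRemainder_div (α : ι → ℝ) (u : ℝ) (K : ℕ) (s : ℂ) :
    MeromorphicAt (fun s => expRemainder α u K s / s) s := by
  unfold expRemainder expKernel
  refine .div (.sub (.mul (AnalyticAt.meromorphicAt (by fun_prop)) (.fun_prod fun j _ =>
    .inv (AnalyticAt.meromorphicAt (by fun_prop)))) ?_) analyticAt_id.meromorphicAt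
  exact (Finset.analyticAt_fun_sum _ fun n _ => by fun_prop).meromorphicAt

lemma analyticAt_sum_halfStep_exp (α : ι → ℝ) (u : ℝ) (K : ℕ) (s : ℂ) :
    AnalyticAt ℂ (fun s => ∑ n ∈ latticeBox ι K,
      halfStep (u - linForm α n) * exp ((u - linForm α n : ℝ) * s)) s :=
  Finset.analyticAt_fun_sum _ fun n _ => by fun_prop

lemma expRemainder_div_sub_residue_isBigO_one {α : ι → ℝ} (hα : ∀ j, α j ≠ 0)
    (hirr : Pairwise fun i j => Irrational (α i / α j)) (u : ℝ) (K : ℕ) (j : ι) {k : ℤ}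
    (hk : k ≠ 0) :
    (fun s => expRemainder α u K s / s - expResidue α u j k * (s - expPole α j k)⁻¹)
      =O[𝓝[≠] (expPole α j k)] fun _ => (1 : ℂ) := by
  obtain ⟨p, hp⟩ : ∃ p, p = expPole α j k := ⟨_, rfl⟩
  have hp0 : p ≠ 0 := hp ▸ expPole_ne_zero (hα j) hk
  have hexp : exp (-(α j * p)) = 1 := (exp_neg_mul_eq_one_iff (hα j)).2 ⟨k, hp⟩
  have hne : ∀ i ∈ Finset.univ.erase j, 1 - exp (-(α i * p)) ≠ 0 := fun i hi h => by
    obtain ⟨m, hm⟩ := (exp_neg_mul_eq_one_iff (hα i)).1 (sub_eq_zero.1 h).symm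
    exact Finset.ne_of_mem_erase hi (eq_of_expPole_eq hα hirr hk (hp ▸ hm)).1.symm
  have hderiv : deriv (fun s : ℂ => 1 - exp (-(α j * s))) p = α j := by
    have := (((hasDerivAt_id p).const_mul (α j : ℂ)).neg.cexp.const_sub 1).deriv
    simpa [hexp] using this
  have hsimple := div_sub_inv_sub_isBigO_one (q := fun s => 1 - exp (-(α j * s)))
    (E := fun s => exp (u * s) / s * ∏ i ∈ Finset.univ.erase j, (1 - exp (-(α i * s)))⁻¹)
    ((AnalyticAt.div (by fun_prop) analyticAt_id hp0).mul
      (Finset.analyticAt_fun_prod _ fun i hi => .inv (by fun_prop) (hne i hi)))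
    (by fun_prop) (by simp [hexp]) (by simpa [hderiv] using hα j)
  have hsum := isBigO_one_of_continuousAt
    ((analyticAt_sum_halfStep_exp α u K p).div analyticAt_id hp0).continuousAt
  rw [← hp]
  refine (hsimple.sub hsum).congr_left fun s => ?_
  simp only [expRemainder, expKernel, expResidue, hderiv, ← hp, Pi.div_apply, id,
    ← Finset.mul_prod_erase _ _ (Finset.mem_univ j), div_eq_mul_inv]
  ring

/-- The principal part of `expRemainder α u K s / s` at `0`, as a polynomial in `s⁻¹`. -/
noncomputable def principalPartZero (α : ι → ℝ) (u : ℝ) (K : ℕ) : Polynomial ℂ :=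
  (((kernelSeries α u).trunc (Fintype.card ι + 1)).reflect (Fintype.card ι + 1)).map
      (algebraMap ℝ ℂ)
    - Polynomial.C (∑ n ∈ latticeBox ι K, (halfStep (u - linForm α n) : ℂ)) * Polynomial.X

lemma coeff_one_principalPartZero (α : ι → ℝ) (u : ℝ) (K : ℕ) :
    (principalPartZero α u K).coeff 1
      = polyPart α u - ∑ n ∈ latticeBox ι K, (halfStep (u - linForm α n) : ℂ) := by
  simp [principalPartZero, polyPart, Polynomial.coeff_reflect, Polynomial.revAt_le,
    PowerSeries.coeff_trunc]

lemma expRemainder_div_sub_principalPartZero_isBigO_one {α : ι → ℝ} (hα : ∀ j, α j ≠ 0) (u : ℝ)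
    (K : ℕ) : (fun s => expRemainder α u K s / s - (principalPartZero α u K).eval s⁻¹)
      =O[𝓝[≠] 0] fun _ => (1 : ℂ) := by
  have hsum := div_sub_inv_sub_isBigO_one (analyticAt_sum_halfStep_exp α u K 0) analyticAt_id rfl
    (by simp)
  have hkernel : (fun s => expKernel α u s / s - Polynomial.aeval s⁻¹
      (((kernelSeries α u).trunc (Fintype.card ι + 1)).reflect (Fintype.card ι + 1)))
        =O[𝓝[≠] 0] fun _ => (1 : ℂ) := by
    refine ((hasTaylorExpansion_kernel hα u (Fintype.card ι + 1)).mul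
      (Asymptotics.isBigO_refl (fun s : ℂ => s⁻¹ ^ (Fintype.card ι + 1)) _)).congr' ?_ ?_ <;>
      filter_upwards [self_mem_nhdsWithin] with s hs
    · have hs0 : s ≠ 0 := hs
      have := invertibleOfNonzero hs0
      have hreflect := Polynomial.eval₂_reflect_mul_pow (algebraMap ℝ ℂ) s (Fintype.card ι + 1)
        ((kernelSeries α u).trunc (Fintype.card ι + 1)) (PowerSeries.natDegree_trunc_lt _ _).le
      rw [Polynomial.aeval_def, ← hreflect, invOf_eq_inv, Polynomial.aeval_def, sub_mul, inv_pow,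
        mul_inv_cancel_right₀ (pow_ne_zero _ hs), pow_succ]
      field_simp
    · rw [← mul_pow, mul_inv_cancel₀ hs, one_pow]
  refine (hkernel.sub hsum).congr_left fun s => ?_
  simp only [principalPartZero, expRemainder, Polynomial.aeval_def, Polynomial.eval_sub,
    Polynomial.eval_mul, Polynomial.eval_C, Polynomial.eval_X, Polynomial.eval_map, sub_div,
    mul_zero, exp_zero, mul_one, deriv_id, div_one, sub_zero, id]
  ring

lemma rectIntegral_expRemainder_div {α : ι → ℝ} (hα : ∀ j, 0 < α j)
    (hirr : Pairwise fun i j => Irrational (α i / α j)) (u : ℝ) (K : ℕ) {δ : ℝ} (hδ : 0 < δ)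
    {R : ℝ} (hR : 0 < R) (hsep : R ∈ separatedSet α δ) :
    rectIntegral (fun s => expRemainder α u K s / s) (-rectCorner R) (rectCorner R)
      = 2 * Real.pi * I * (polyPart α u - ∑ n ∈ latticeBox ι K, (halfStep (u - linForm α n) : ℂ)
        + residueSum α u R) := by
  have hα0 (j : ι) : α j ≠ 0 := (hα j).ne'
  have hmem {x : Σ _ : ι, ℤ} := mem_poleIndex (x := x) (fun j => (hα j).le) hR.le
  have hcoeff := rectIntegral_eq_sum_coeff (S := (poleIndex α R).insertNone)
    (f := fun s => expRemainder α u K s / s) (z := -rectCorner R) (w := rectCorner R)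
    (pole := fun o => o.elim 0 fun x => expPole α x.1 x.2)
    (P := fun o => o.elim (principalPartZero α u K)
      fun x => Polynomial.C (expResidue α u x.1 x.2) * Polynomial.X) ?_ ?_
    (fun s _ => meromorphicAt_expRemainder_div α u K s) ?_ ?_
  · simpa [Finset.sum_insertNone, coeff_one_principalPartZero, residueSum] using hcoeff
  · rintro (_ | x) hx (_ | y) hy h
    · rfl
    · exact absurd h.symm (expPole_ne_zero (hα0 _) (hmem.1 (Finset.some_mem_insertNone.1 hy)).1)
    · exact absurd h (expPole_ne_zero (hα0 _) (hmem.1 (Finset.some_mem_insertNone.1 hx)).1)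
    · obtain ⟨hj, hk⟩ :=
        eq_of_expPole_eq hα0 hirr (hmem.1 (Finset.some_mem_insertNone.1 hx)).1 h
      exact congr_arg some (Sigma.ext hj (heq_of_eq hk))
  · rintro (_ | x) hx
    · simpa [mem_reProdIm, rectCorner_re, rectCorner_im] using mul_pos Real.two_pi_pos hR
    · exact expPole_mem_rect hα hδ hR hsep (Finset.some_mem_insertNone.1 hx)
  · intro ζ hζ hne
    have hζ0 : ζ ≠ 0 := hne none (Finset.none_mem_insertNone)
    refine (analyticAt_expRemainder u K fun j hj => ?_).div analyticAt_id hζ0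
    obtain ⟨k, rfl⟩ := (exp_neg_mul_eq_one_iff (hα0 j)).1 hj
    refine hne (some ⟨j, k⟩) (Finset.some_mem_insertNone.2 (hmem.2 ⟨?_, ?_⟩)) rfl
    · rintro rfl
      exact hζ0 (by simp [expPole])
    · have him := (mem_reProdIm.1 hζ).2
      rw [neg_im, uIcc_of_le (by rw [rectCorner_im]; linarith [mul_pos Real.two_pi_pos hR]),
        rectCorner_im] at him
      exact (abs_expPole_im_le_iff (hα j)).1 (abs_le.2 him)
  · rintro (_ | x) hx
    · simpa using expRemainder_div_sub_principalPartZero_isBigO_one hα0 u K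
    · simpa using expRemainder_div_sub_residue_isBigO_one hα0 hirr u K x.1
        (hmem.1 (Finset.some_mem_insertNone.1 hx)).1

theorem tendsto_residueSum [Nonempty ι] {α : ι → ℝ} (hα : ∀ j, 0 < α j)
    (hirr : Pairwise fun i j => Irrational (α i / α j)) {u : ℝ} (hu : 0 ≤ u) {δ : ℝ} (hδ : 0 < δ) :
    Tendsto (residueSum α u) (separatedFilter α δ)
      (𝓝 ((halfCount α u - polyPart α u : ℝ) : ℂ)) := by
  obtain ⟨K, hK⟩ := exists_forall_lt_mul hα u
  have hlim := ((tendsto_rectIntegral_expRemainder_div hα hu hK hδ).const_mul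
    (2 * Real.pi * I)⁻¹).const_add ((halfCount α u - polyPart α u : ℝ) : ℂ)
  rw [mul_zero, add_zero] at hlim
  refine hlim.congr' ?_
  filter_upwards [mem_inf_of_right (mem_principal_self _), mem_inf_of_left (eventually_gt_atTop 0)]
    with R hsep hR
  rw [rectIntegral_expRemainder_div hα hirr u K hδ hR hsep,
    inv_mul_cancel_left₀ two_pi_I_ne_zero, halfCount_eq_sum hα hK]
  push_cast
  ring

end Residues

section CotangentSums

open Complex ComplexConjugate

lemma sum_Icc_neg_erase_zero {A : Type*} [AddCommMonoid A] (g : ℤ → A) (K : ℕ) :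
    ∑ k ∈ (Finset.Icc (-(K : ℤ)) K).erase 0, g k = ∑ k ∈ Finset.Icc 1 K, (g k + g (-k)) := by
  induction K with
  | zero => simp
  | succ K ih =>
    have hstep : (Finset.Icc (-((K + 1 : ℕ) : ℤ)) (K + 1 : ℕ)).erase 0
        = insert ((K + 1 : ℕ) : ℤ) (insert (-((K + 1 : ℕ) : ℤ))
          ((Finset.Icc (-(K : ℤ)) K).erase 0)) := by
      ext k
      simp only [Finset.mem_erase, Finset.mem_Icc, Finset.mem_insert]
      omega
    rw [Finset.sum_Icc_succ_top (by omega), ← ih, hstep, Finset.sum_insert, Finset.sum_insert,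
      ← add_assoc, add_comm]
    · simp
    · simp only [Finset.mem_insert, Finset.mem_erase, Finset.mem_Icc]
      omega

lemma inv_one_sub_exp_neg_two_mul_I {θ : ℝ} (hθ : Real.sin θ ≠ 0) :
    (1 - exp (-(2 * θ * I)))⁻¹ = (1 - Real.cot θ * I) / 2 := by
  have hsin : (Real.sin θ : ℂ) ≠ 0 := ofReal_ne_zero.2 hθ
  have hexp : exp (-(2 * θ * I)) = (Real.cos θ - Real.sin θ * I) ^ 2 := by
    have hneg : cos θ - sin θ * I = exp (-θ * I) := by
      rw [exp_mul_I, cos_neg, sin_neg, neg_mul, sub_eq_add_neg]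
    rw [ofReal_cos, ofReal_sin, hneg, ← exp_nat_mul]
    push_cast
    ring_nf
  have hsq : (Real.sin θ : ℂ) ^ 2 + (Real.cos θ : ℂ) ^ 2 = 1 := by
    exact_mod_cast Real.sin_sq_add_cos_sq θ
  refine inv_eq_of_mul_eq_one_right ?_
  rw [hexp, Real.cot_eq_cos_div_sin, ofReal_div]
  field_simp
  linear_combination (Real.sin θ + Real.cos θ * I) * hsq
    - (Real.sin θ ^ 2 * (Real.sin θ - Real.cos θ * I) + 2 * Real.sin θ * Real.cos θ ^ 2) * I_sq

variable {ι : Type*} {α : ι → ℝ}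

lemma sin_pi_mul_ratio_ne_zero (hα : ∀ j, α j ≠ 0)
    (hirr : Pairwise fun i j => Irrational (α i / α j)) {i j : ι} (hij : i ≠ j) {k : ℤ}
    (hk : k ≠ 0) : Real.sin (Real.pi * k * α i / α j) ≠ 0 := by
  rw [Real.sin_ne_zero_iff]
  intro m hm
  refine (hirr hij).ne_rat (m / k : ℚ) ?_
  have hk' : (k : ℝ) ≠ 0 := Int.cast_ne_zero.2 hk
  have hj := hα j
  have hpi := Real.pi_ne_zero
  push_cast
  field_simp at hm ⊢
  linarith

lemma expPole_neg (α : ι → ℝ) (j : ι) (k : ℤ) : expPole α j (-k) = conj (expPole α j k) := by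
  rw [expPole_eq_ofReal_mul_I, expPole_eq_ofReal_mul_I, map_mul, conj_ofReal, conj_I]
  push_cast
  ring

variable [Fintype ι] [DecidableEq ι]

lemma expResidue_neg (α : ι → ℝ) (u : ℝ) (j : ι) (k : ℤ) :
    expResidue α u j (-k) = conj (expResidue α u j k) := by
  simp [expResidue, expPole_neg, ← exp_conj]

lemma expResidue_eq (hα : ∀ j, α j ≠ 0) (hirr : Pairwise fun i j => Irrational (α i / α j))
    (u : ℝ) (j : ι) {k : ℤ} (hk : k ≠ 0) :
    expResidue α u j k = exp ((2 * Real.pi * k * (u / α j) : ℝ) * I)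
      * (∏ i ∈ Finset.univ.erase j, (1 - Real.cot (Real.pi * k * α i / α j) * I) / 2)
      / (2 * Real.pi * k : ℝ) / I := by
  have hfactor (i : ι) (hi : i ∈ Finset.univ.erase j) :
      (1 - exp (-(α i * expPole α j k)))⁻¹
        = (1 - Real.cot (Real.pi * k * α i / α j) * I) / 2 := by
    rw [← inv_one_sub_exp_neg_two_mul_I
      (sin_pi_mul_ratio_ne_zero hα hirr (Finset.ne_of_mem_erase hi) hk), expPole]
    push_cast
    ring_nf
  have hj : (α j : ℂ) ≠ 0 := ofReal_ne_zero.2 (hα j)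
  rw [expResidue, Finset.prod_congr rfl hfactor, expPole_eq_ofReal_mul_I, ← mul_assoc,
    ← ofReal_mul, mul_div_left_comm u]
  push_cast
  field_simp

/-- Up to the factor `1 / π`, the contribution of the poles `expPole α j k`, `k ≠ 0`, to
`residueSum α u R`, where the poles with opposite `k` are taken together. -/
noncomputable def cotProdSum (α : ι → ℝ) (u : ℝ) (j : ι) (R : ℝ) : ℝ :=
  ∑ k ∈ Finset.Icc 1 ⌊R * α j⌋₊, (exp ((2 * Real.pi * k * (u / α j) : ℝ) * I)
    * ∏ i ∈ Finset.univ.erase j, (1 - Real.cot (Real.pi * k * α i / α j) * I) / 2).im / k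

lemma residueSum_eq_sum_cotProdSum (hα : ∀ j, α j ≠ 0)
    (hirr : Pairwise fun i j => Irrational (α i / α j)) (u R : ℝ) :
    residueSum α u R = ((∑ j, cotProdSum α u j R) / Real.pi : ℝ) := by
  simp only [residueSum, poleIndex, cotProdSum, Finset.sum_sigma, sum_Icc_neg_erase_zero,
    Finset.sum_div, ofReal_sum]
  refine Finset.sum_congr rfl fun j _ => Finset.sum_congr rfl fun k hk => ?_
  have hk0 : (k : ℤ) ≠ 0 := by
    have := (Finset.mem_Icc.1 hk).1
    omega
  rw [expResidue_neg, add_conj, expResidue_eq hα hirr u j hk0, div_I, neg_re, mul_I_re, neg_neg,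
    div_ofReal_im, Int.cast_natCast]
  congr 1
  field_simp

lemma tendsto_sum_cotProdSum [Nonempty ι] (hα : ∀ j, 0 < α j)
    (hirr : Pairwise fun i j => Irrational (α i / α j)) {u : ℝ} (hu : 0 ≤ u) {δ : ℝ} (hδ : 0 < δ) :
    Tendsto (fun R => ∑ j, cotProdSum α u j R) (separatedFilter α δ)
      (𝓝 (Real.pi * (halfCount α u - polyPart α u))) := by
  have hlim := tendsto_ofReal_iff.1 ((tendsto_residueSum hα hirr hu hδ).congr
    (residueSum_eq_sum_cotProdSum (fun j => (hα j).ne') hirr u))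
  exact (hlim.const_mul Real.pi).congr fun R => mul_div_cancel₀ _ Real.pi_ne_zero

/-- The sum over `1 ≤ k ≤ ⌊R log a⌋` of `sin (2 π k log x / log a) / k`. -/
noncomputable def sinSum (a : ℕ) (x R : ℝ) : ℝ :=
  ∑ k ∈ Finset.Icc 1 ⌊R * Real.log a⌋₊,
    Real.sin (2 * Real.pi * k * (Real.log x / Real.log a)) / k

lemma cotProdSum_log_of_erase_eq_empty {j : ι} (hj : Finset.univ.erase j = ∅) (a : ι → ℕ)
    (x R : ℝ) :
    cotProdSum (fun j => Real.log (a j)) (Real.log x) j R = sinSum (a j) x R := by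
  simp only [cotProdSum, sinSum, hj, Finset.prod_empty, mul_one, exp_ofReal_mul_I_im]

lemma cotProdSum_log_of_erase_eq_singleton {j i : ι} (hj : Finset.univ.erase j = {i}) (a : ι → ℕ)
    (x R : ℝ) :
    cotProdSum (fun j => Real.log (a j)) (Real.log x) j R
      = (sinSum (a j) x R - cotCosSum (a j) (a i) x R) / 2 := by
  have him (φ c : ℝ) : (exp (φ * I) * ((1 - c * I) / 2)).im
      = (Real.sin φ - Real.cos φ * c) / 2 := by
    simp [mul_im, exp_ofReal_mul_I_re, exp_ofReal_mul_I_im]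
    ring
  simp only [cotProdSum, sinSum, cotCosSum, hj, Finset.prod_singleton, him,
    Real.cot_eq_cos_div_sin, ← Finset.sum_sub_distrib, Finset.sum_div]
  exact Finset.sum_congr rfl fun k _ => by ring

lemma cotProdSum_log_of_erase_eq_pair {j i l : ι} (hil : i ≠ l)
    (hj : Finset.univ.erase j = {i, l}) (a : ι → ℕ) (x R : ℝ) :
    cotProdSum (fun j => Real.log (a j)) (Real.log x) j R
      = (sinSum (a j) x R - cotCosSum (a j) (a i) x R - cotCosSum (a j) (a l) x R
        - cotCotSinSum (a j) (a i) (a l) x R) / 4 := by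
  have him (φ c d : ℝ) : (exp (φ * I) * ((1 - c * I) / 2 * ((1 - d * I) / 2))).im
      = (Real.sin φ - Real.cos φ * c - Real.cos φ * d - c * d * Real.sin φ) / 4 := by
    simp [mul_im, mul_re, exp_ofReal_mul_I_re, exp_ofReal_mul_I_im]
    ring
  simp only [cotProdSum, sinSum, cotCosSum, cotCotSinSum, hj, Finset.prod_pair hil, him,
    Real.cot_eq_cos_div_sin, ← Finset.sum_sub_distrib, Finset.sum_div]
  exact Finset.sum_congr rfl fun k _ => by ring

end CotangentSums

section SmoothNumbers

lemma halfStep_sub (u l : ℝ) :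
    halfStep (u - l) = (if l ≤ u then 1 else 0) - (if l = u then 1 else 0) / 2 := by
  rcases lt_trichotomy u l with h | rfl | h
  · simp [halfStep_of_neg (sub_neg.2 h), h.not_ge, h.ne']
  · norm_num [halfStep_zero]
  · simp [halfStep_of_pos (sub_pos.2 h), h.le, h.ne]

lemma halfCount_eq_ncard_sub_ncard {ι : Type*} [Fintype ι] {α : ι → ℝ} (hα : ∀ j, 0 < α j)
    (u : ℝ) : halfCount α u
      = {n : ι → ℕ | linForm α n ≤ u}.ncard - ({n : ι → ℕ | linForm α n = u}.ncard : ℝ) / 2 := by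
  classical
  obtain ⟨K, hK⟩ := exists_forall_lt_mul hα u
  have hncard (p : (ι → ℕ) → Prop) (hp : ∀ n, p n → linForm α n ≤ u) :
      ((latticeBox ι K).filter p).card = {n | p n}.ncard := by
    rw [← Set.ncard_coe_finset]
    congr 1
    ext n
    simpa using fun hn => mem_latticeBox hα hK (hp n hn)
  rw [halfCount_eq_sum hα hK]
  simp only [halfStep_sub, Finset.sum_sub_distrib, ← Finset.sum_div, Finset.sum_boole]
  rw [hncard _ fun n => id, hncard _ fun n => le_of_eq]

lemma halfCount_sub_polyPart_one {α : Fin 1 → ℝ} (hα : 0 < α 0) {u : ℝ} (hu : 0 ≤ u) :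
    halfCount α u - polyPart α u = -bernoulliOneStar (u / α 0) := by
  have hlin (n : Fin 1 → ℕ) : linForm α n = n 0 * α 0 := by simp [linForm]
  have hncard (p : ℕ → Prop) : {n : Fin 1 → ℕ | p (n 0)}.ncard = {m | p m}.ncard :=
    Nat.card_congr ((Equiv.funUnique (Fin 1) ℕ).subtypeEquiv fun _ => Iff.rfl)
  have hy : 0 ≤ u / α 0 := div_nonneg hu hα.le
  have hle : {m : ℕ | m * α 0 ≤ u}.ncard = ⌊u / α 0⌋₊ + 1 := by
    have : {m : ℕ | m * α 0 ≤ u} = Finset.range (⌊u / α 0⌋₊ + 1) := by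
      ext m
      simp [← le_div_iff₀ hα, ← Nat.le_floor_iff hy]
    rw [this, Set.ncard_coe_finset, Finset.card_range]
  have hfract : Int.fract (u / α 0) = u / α 0 - ⌊u / α 0⌋₊ := by
    rw [Int.fract, natCast_floor_eq_intCast_floor hy]
  have heq : ({m : ℕ | m * α 0 = u}.ncard : ℝ) = if Int.fract (u / α 0) = 0 then 1 else 0 := by
    simp only [← eq_div_iff hα.ne']
    split_ifs with h
    · rw [sub_eq_zero.1 (hfract.symm.trans h)]
      simp
    · have hempty : {m : ℕ | (m : ℝ) = u / α 0} = ∅ := by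
        refine Set.eq_empty_of_forall_notMem fun m (hm : (m : ℝ) = u / α 0) => h ?_
        rw [← hm, Int.fract_natCast]
      rw [hempty, Set.ncard_empty, Nat.cast_zero]
  rw [halfCount_eq_ncard_sub_ncard (by simpa using hα), polyPart_one hα.ne']
  simp only [hlin]
  rw [hncard fun m => m * α 0 ≤ u, hncard fun m => m * α 0 = u, hle, heq, bernoulliOneStar]
  split_ifs <;> push_cast <;> linarith

variable {ι : Type*}

lemma tendsto_sinSum {a : ι → ℕ} (ha : ∀ j, 0 < Real.log (a j)) {x : ℝ} (hx : 1 ≤ x) {δ : ℝ}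
    (hδ : 0 < δ) (j : ι) :
    Tendsto (sinSum (a j) x) (separatedFilter (fun j => Real.log (a j)) δ)
      (𝓝 (-(Real.pi * bernoulliOneStar (Real.log x / Real.log (a j))))) := by
  have hlim := tendsto_sum_cotProdSum (α := fun _ : Fin 1 => Real.log (a j)) (fun _ => ha j)
    Subsingleton.pairwise (Real.log_nonneg hx) hδ
  rw [halfCount_sub_polyPart_one (ha j) (Real.log_nonneg hx), mul_neg] at hlim
  refine (hlim.congr fun R => ?_).mono_left (separatedFilter_le_comp _ δ fun _ => j)
  rw [Fin.sum_univ_one]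
  exact cotProdSum_log_of_erase_eq_empty (by decide) (fun _ => a j) x R

lemma exists_tendsto_cotCosSum {a : ι → ℕ} (ha : ∀ j, 0 < Real.log (a j))
    (hirr : Pairwise fun i j => Irrational (Real.log (a i) / Real.log (a j))) {x : ℝ} (hx : 1 ≤ x)
    {i j : ι} (hij : i ≠ j) :
    ∃ P, ∀ δ > 0, Tendsto (fun R => cotCosSum (a i) (a j) x R + cotCosSum (a j) (a i) x R)
      (separatedFilter (fun j => Real.log (a j)) δ) (𝓝 P) := by
  have hinj : Function.Injective ![i, j] := by
    simpa [Function.Injective, Fin.forall_fin_two, eq_comm] using hij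
  set b : Fin 2 → ℕ := a ∘ ![i, j]
  refine ⟨-(Real.pi * bernoulliOneStar (Real.log x / Real.log (a i)))
    + -(Real.pi * bernoulliOneStar (Real.log x / Real.log (a j)))
    - 2 * (Real.pi * (halfCount (fun l => Real.log (b l)) (Real.log x)
      - polyPart (fun l => Real.log (b l)) (Real.log x))), fun δ hδ => ?_⟩
  have hlim := (tendsto_sum_cotProdSum (α := fun l => Real.log (b l)) (fun l => ha _)
    (hirr.comp_of_injective hinj) (Real.log_nonneg hx) hδ).mono_left
      (separatedFilter_le_comp (fun j => Real.log (a j)) δ ![i, j])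
  refine (((tendsto_sinSum ha hx hδ i).add (tendsto_sinSum ha hx hδ j)).sub
    (hlim.const_mul 2)).congr fun R => ?_
  rw [Fin.sum_univ_two, cotProdSum_log_of_erase_eq_singleton (i := 1) (by decide) b,
    cotProdSum_log_of_erase_eq_singleton (i := 0) (by decide) b]
  simp only [b, Function.comp_apply, Matrix.cons_val_zero, Matrix.cons_val_one]
  ring

lemma tendsto_cotCotSinSum {a : Fin 3 → ℕ} (ha : ∀ j, 0 < Real.log (a j))
    (hirr : Pairwise fun i j => Irrational (Real.log (a i) / Real.log (a j))) {x : ℝ} (hx : 1 ≤ x)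
    {δ : ℝ} (hδ : 0 < δ) {P₁ P₂ P₃ : ℝ}
    (h₁ : Tendsto (fun R => cotCosSum (a 0) (a 1) x R + cotCosSum (a 1) (a 0) x R)
      (separatedFilter (fun j => Real.log (a j)) δ) (𝓝 P₁))
    (h₂ : Tendsto (fun R => cotCosSum (a 1) (a 2) x R + cotCosSum (a 2) (a 1) x R)
      (separatedFilter (fun j => Real.log (a j)) δ) (𝓝 P₂))
    (h₃ : Tendsto (fun R => cotCosSum (a 2) (a 0) x R + cotCosSum (a 0) (a 2) x R)
      (separatedFilter (fun j => Real.log (a j)) δ) (𝓝 P₃)) :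
    Tendsto (fun R => cotCotSinSum (a 0) (a 1) (a 2) x R + cotCotSinSum (a 1) (a 0) (a 2) x R
        + cotCotSinSum (a 2) (a 0) (a 1) x R)
      (separatedFilter (fun j => Real.log (a j)) δ)
      (𝓝 (-(Real.pi * ∑ j, bernoulliOneStar (Real.log x / Real.log (a j))) - P₁ - P₂ - P₃
        - 4 * (Real.pi * (halfCount (fun j => Real.log (a j)) (Real.log x)
          - cubicPart (a 0) (a 1) (a 2) x)))) := by
  have hsin := tendsto_finsetSum Finset.univ fun j _ => tendsto_sinSum ha hx hδ j
  have hlim := tendsto_sum_cotProdSum ha hirr (Real.log_nonneg hx) hδ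
  rw [Finset.sum_neg_distrib, ← Finset.mul_sum] at hsin
  rw [polyPart_log_three fun j => (ha j).ne'] at hlim
  refine ((((hsin.sub h₁).sub h₂).sub h₃).sub (hlim.const_mul 4)).congr fun R => ?_
  rw [Fin.sum_univ_three, Fin.sum_univ_three,
    cotProdSum_log_of_erase_eq_pair (i := 1) (l := 2) (by decide) (by decide),
    cotProdSum_log_of_erase_eq_pair (i := 0) (l := 2) (by decide) (by decide),
    cotProdSum_log_of_erase_eq_pair (i := 0) (l := 1) (by decide) (by decide)]
  ring

lemma exists_separatedFilter_neBot [Finite ι] {α : ι → ℝ} (hα : ∀ j, 0 < α j) :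
    ∃ δ > 0, (separatedFilter α δ).NeBot := by
  have := Fintype.ofFinite ι
  have hsmall {c C : ℝ} (hc : 0 < c) : ∀ᶠ t in 𝓝[>] (0 : ℝ), t * C ≤ c :=
    ((continuous_mul_const C).tendsto' 0 0 (zero_mul C)).eventually_le_const hc
      |>.filter_mono nhdsWithin_le_nhds
  obtain ⟨η, hη, hηα⟩ : ∃ η > 0, ∀ j, η * (Fintype.card ι * α j) ≤ 1 / 2 :=
    (eventually_mem_nhdsWithin.and (eventually_all.2 fun j => hsmall one_half_pos)).exists
  obtain ⟨δ, hδ, hδα, hδ4⟩ : ∃ δ > 0, (∀ j, δ * 2 ≤ η * α j) ∧ δ * 4 ≤ 1 :=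
    (eventually_mem_nhdsWithin.and ((eventually_all.2 fun j =>
      hsmall (mul_pos hη (hα j))).and (hsmall one_pos))).exists
  refine ⟨δ, hδ, frequently_mem_iff_neBot.1 (frequently_atTop.2 fun X => ?_)⟩
  by_contra! hcon
  have hbad (i : Fin (Fintype.card ι + 1)) : ∃ j, ∃ m : ℤ, |(X + i * η) * α j - m| < δ := by
    have := hcon (X + i * η) (le_add_of_nonneg_right (by positivity))
    simpa [separatedSet] using this
  choose j m hm using hbad
  obtain ⟨i, i', hne, hj⟩ := Fintype.exists_ne_map_eq_of_card_lt j (by simp)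
  wlog hlt : i < i' generalizing i i'
  · exact this i' i hne.symm hj.symm (hne.lt_or_gt.resolve_left hlt)
  have hi := abs_lt.1 (hm i)
  have hi' := abs_lt.1 (hj ▸ hm i')
  have hgap : 1 ≤ (i' - i : ℝ) := by
    rw [le_sub_iff_add_le']
    exact_mod_cast Fin.lt_def.1 hlt
  have hle : (i' - i : ℝ) ≤ Fintype.card ι := by
    rw [sub_le_iff_le_add']
    exact_mod_cast (Nat.lt_succ_iff.1 i'.isLt).trans (Nat.le_add_left _ _)
  have hηj : 0 < η * α (j i) := mul_pos hη (hα _)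
  have hlower : (m i : ℝ) < m i' := by
    nlinarith [mul_le_mul_of_nonneg_right hgap hηj.le, hδα (j i)]
  have hupper : (m i' : ℝ) < m i + 1 := by
    nlinarith [mul_le_mul_of_nonneg_right hle hηj.le, hηα (j i)]
  norm_cast at hlower hupper
  omega

variable [Fintype ι]

lemma one_lt_of_injective_prod_pow {a : ι → ℕ}
    (h : Function.Injective fun n : ι → ℕ => ∏ j, a j ^ n j) (j : ι) : 1 < a j := by
  classical
  have hpow : Function.Injective fun p : ℕ => a j ^ p := fun p q hpq => by
    refine Pi.single_injective (M := fun _ => ℕ) j (h ?_)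
    simpa [Pi.single_apply, pow_ite] using hpq
  by_contra! hle
  obtain h0 | h1 := Nat.le_one_iff_eq_zero_or_eq_one.1 hle
  · exact absurd (@hpow 1 2 (by simp [h0])) (by decide)
  · exact absurd (@hpow 0 1 (by simp [h1])) (by decide)

lemma linForm_log {a : ι → ℕ} (ha : ∀ j, 0 < a j) (n : ι → ℕ) :
    linForm (fun j => Real.log (a j)) n = Real.log (∏ j, a j ^ n j : ℕ) := by
  push_cast
  rw [Real.log_prod fun j _ => pow_ne_zero _ (Nat.cast_ne_zero.2 (ha j).ne')]
  simp only [Real.log_pow, linForm]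

lemma injective_linForm_log {a : ι → ℕ}
    (h : Function.Injective fun n : ι → ℕ => ∏ j, a j ^ n j) :
    Function.Injective (linForm fun j => Real.log (a j)) := by
  have ha (j : ι) : 0 < a j := zero_lt_one.trans (one_lt_of_injective_prod_pow h j)
  have hpos (n : ι → ℕ) : (0 : ℝ) < (∏ j, a j ^ n j : ℕ) :=
    Nat.cast_pos.2 (Finset.prod_pos fun j _ => pow_pos (ha j) _)
  intro n m hnm
  rw [linForm_log ha, linForm_log ha] at hnm
  exact h (Nat.cast_injective (Real.log_injOn_pos (hpos n) (hpos m) hnm))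

lemma irrational_div_of_injective_linForm {α : ι → ℝ} (hα : ∀ j, 0 < α j)
    (h : Function.Injective (linForm α)) : Pairwise fun i j => Irrational (α i / α j) := by
  classical
  have hsingle (i : ι) (m : ℕ) : linForm α (Pi.single i m) = m * α i := by
    simp [linForm, Pi.single_apply]
  rintro i j hij ⟨q, hq⟩
  have hq0 : 0 ≤ q := by exact_mod_cast hq ▸ (div_pos (hα i) (hα j)).le
  lift q to ℚ≥0 using hq0
  have hrel : q.den * α i = q.num * α j := by
    rw [eq_div_iff (hα j).ne'] at hq
    rw [← hq, ← mul_assoc]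
    congr 1
    exact_mod_cast q.den_mul_eq_num
  rw [← hsingle, ← hsingle] at hrel
  have hden := congr_fun (h hrel) i
  rw [Pi.single_eq_same, Pi.single_eq_of_ne hij] at hden
  exact q.den_ne_zero hden

lemma injective_prod_pow_of_pairwise_coprime {a : ι → ℕ} (ha : ∀ j, 1 < a j)
    (hcop : Pairwise fun i j => Nat.Coprime (a i) (a j)) :
    Function.Injective fun n : ι → ℕ => ∏ j, a j ^ n j := by
  classical
  have hle {n m : ι → ℕ} (h : ∏ j, a j ^ n j = ∏ j, a j ^ m j) (j : ι) : n j ≤ m j := by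
    have hdvd : a j ^ n j ∣ a j ^ m j * ∏ i ∈ Finset.univ.erase j, a i ^ m i := by
      rw [Finset.mul_prod_erase _ (fun i => a i ^ m i) (Finset.mem_univ j), ← h]
      exact Finset.dvd_prod_of_mem _ (Finset.mem_univ j)
    refine (Nat.pow_dvd_pow_iff_le_right (ha j)).1 (Nat.Coprime.dvd_of_dvd_mul_right ?_ hdvd)
    exact Nat.Coprime.prod_right fun i hi => (hcop (Finset.ne_of_mem_erase hi).symm).pow _ _
  exact fun n m h => funext fun j => (hle h j).antisymm (hle h.symm j)

lemma ncard_linForm_eq {α : ι → ℝ} (h : Function.Injective (linForm α)) (u : ℝ) :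
    ({n : ι → ℕ | linForm α n = u}.ncard : ℝ) = (Set.range (linForm α)).indicator 1 u := by
  by_cases hu : u ∈ Set.range (linForm α)
  · obtain ⟨m, rfl⟩ := hu
    simp [h.eq_iff]
  · have hempty : {n : ι → ℕ | linForm α n = u} = ∅ :=
      Set.eq_empty_of_forall_notMem fun n hn => hu ⟨n, hn⟩
    rw [hempty, Set.indicator_of_notMem hu, Set.ncard_empty, Nat.cast_zero]

/-- Triples of natural numbers, regarded as functions on `Fin 3`. -/
def tripleEquiv : ℕ × ℕ × ℕ ≃ (Fin 3 → ℕ) where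
  toFun t := ![t.1, t.2.1, t.2.2]
  invFun n := (n 0, n 1, n 2)
  left_inv _ := rfl
  right_inv n := by
    ext j
    fin_cases j <;> rfl

lemma prod_pow_tripleEquiv (a b c : ℕ) (t : ℕ × ℕ × ℕ) :
    ∏ j, ![a, b, c] j ^ tripleEquiv t j = a ^ t.1 * b ^ t.2.1 * c ^ t.2.2 := by
  rw [Fin.prod_univ_three]
  rfl

lemma injective_prod_pow_iff_injective_triple {a b c : ℕ} :
    (Function.Injective fun n : Fin 3 → ℕ => ∏ j, ![a, b, c] j ^ n j)
      ↔ Function.Injective fun t : ℕ × ℕ × ℕ => a ^ t.1 * b ^ t.2.1 * c ^ t.2.2 := by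
  rw [← tripleEquiv.injective_comp, Function.comp_def, funext (prod_pow_tripleEquiv a b c)]

lemma halfCount_log_three {a b c : ℕ}
    (h : Function.Injective fun n : Fin 3 → ℕ => ∏ j, ![a, b, c] j ^ n j) {x : ℝ} (hx : 0 < x) :
    halfCount (fun j => Real.log (![a, b, c] j)) (Real.log x)
      = smoothCount a b c x - 1 / 2 * smoothChar a b c x := by
  classical
  have ha := one_lt_of_injective_prod_pow h
  have hlin (t : ℕ × ℕ × ℕ) : linForm (fun j => Real.log (![a, b, c] j)) (tripleEquiv t)
      = Real.log (a ^ t.1 * b ^ t.2.1 * c ^ t.2.2 : ℕ) := by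
    rw [linForm_log fun j => zero_lt_one.trans (ha j), prod_pow_tripleEquiv]
  have hpos (t : ℕ × ℕ × ℕ) : (0 : ℝ) < (a ^ t.1 * b ^ t.2.1 * c ^ t.2.2 : ℕ) := by
    have h0 : 0 < a := zero_lt_one.trans (ha 0)
    have h1 : 0 < b := zero_lt_one.trans (ha 1)
    have h2 : 0 < c := zero_lt_one.trans (ha 2)
    positivity
  have hcount : {n | linForm (fun j => Real.log (![a, b, c] j)) n ≤ Real.log x}.ncard
      = smoothCount a b c x :=
    (Nat.card_congr (tripleEquiv.subtypeEquiv fun t => by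
      simp only [Set.mem_ofPred_eq, hlin, Real.log_le_log_iff (hpos t) hx])).symm
  have hmem : Real.log x ∈ Set.range (linForm fun j => Real.log (![a, b, c] j))
      ↔ x ∈ smoothSet a b c := by
    simp only [← tripleEquiv.surjective.range_comp, Set.mem_range, Function.comp_apply, hlin,
      Prod.exists, smoothSet, Set.mem_ofPred_eq, eq_comm (a := x)]
    exact exists₃_congr fun p q l => Real.log_injOn_pos.eq_iff (hpos (p, q, l)) hx
  rw [halfCount_eq_ncard_sub_ncard fun j => Real.log_pos (Nat.one_lt_cast.2 (ha j)), hcount,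
    ncard_linForm_eq (injective_linForm_log h), smoothChar]
  simp only [Set.indicator_apply, hmem, Pi.one_apply]
  ring

lemma separatedAtTop_eq (a b c : ℕ) (δ : ℝ) :
    separatedAtTop a b c δ = separatedFilter (fun j => Real.log (![a, b, c] j)) δ := by
  simp [separatedAtTop, separatedFilter, separatedSet, Fin.forall_fin_succ, forall_and]

lemma injective_two_three_five :
    Function.Injective fun t : ℕ × ℕ × ℕ => 2 ^ t.1 * 3 ^ t.2.1 * 5 ^ t.2.2 :=
  injective_prod_pow_iff_injective_triple.1 <|
    injective_prod_pow_of_pairwise_coprime (by decide) (by unfold Pairwise; decide)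

end SmoothNumbers

theorem corollary15_general {a b c : ℕ}
    (hinj : Function.Injective (fun t : ℕ × ℕ × ℕ => a ^ t.1 * b ^ t.2.1 * c ^ t.2.2)) :
    (∃ δ : ℝ, 0 < δ ∧ (separatedAtTop a b c δ).NeBot) ∧
      ∀ x : ℝ, 1 ≤ x → ∃ P₁ P₂ P₃ Q : ℝ,
        (∀ δ : ℝ, 0 < δ →
          Tendsto (fun R => cotCosSum a b x R + cotCosSum b a x R)
            (separatedAtTop a b c δ) (𝓝 P₁) ∧
          Tendsto (fun R => cotCosSum b c x R + cotCosSum c b x R)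
            (separatedAtTop a b c δ) (𝓝 P₂) ∧
          Tendsto (fun R => cotCosSum c a x R + cotCosSum a c x R)
            (separatedAtTop a b c δ) (𝓝 P₃) ∧
          Tendsto (fun R => cotCotSinSum a b c x R + cotCotSinSum b a c x R
              + cotCotSinSum c a b x R)
            (separatedAtTop a b c δ) (𝓝 Q)) ∧
        (smoothCount a b c x : ℝ) =
          cubicPart a b c x
            - 1 / 4 * bernoulliOneStar (Real.log x / Real.log a)
            - 1 / 4 * bernoulliOneStar (Real.log x / Real.log b)
            - 1 / 4 * bernoulliOneStar (Real.log x / Real.log c)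
            - 1 / (4 * Real.pi) * P₁ - 1 / (4 * Real.pi) * P₂ - 1 / (4 * Real.pi) * P₃
            - 1 / (4 * Real.pi) * Q
            + 1 / 2 * smoothChar a b c x := by
  have hinj' := injective_prod_pow_iff_injective_triple.2 hinj
  have hlog (j : Fin 3) : 0 < Real.log (![a, b, c] j) :=
    Real.log_pos (Nat.one_lt_cast.2 (one_lt_of_injective_prod_pow hinj' j))
  have hirr := irrational_div_of_injective_linForm hlog (injective_linForm_log hinj')
  simp only [separatedAtTop_eq]
  refine ⟨exists_separatedFilter_neBot hlog, fun x hx => ?_⟩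
  obtain ⟨P₁, h₁⟩ := exists_tendsto_cotCosSum hlog hirr hx (i := 0) (j := 1) (by decide)
  obtain ⟨P₂, h₂⟩ := exists_tendsto_cotCosSum hlog hirr hx (i := 1) (j := 2) (by decide)
  obtain ⟨P₃, h₃⟩ := exists_tendsto_cotCosSum hlog hirr hx (i := 2) (j := 0) (by decide)
  refine ⟨P₁, P₂, P₃, _, fun δ hδ => ⟨h₁ δ hδ, h₂ δ hδ, h₃ δ hδ,
    tendsto_cotCotSinSum hlog hirr hx hδ (h₁ δ hδ) (h₂ δ hδ) (h₃ δ hδ)⟩, ?_⟩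
  rw [halfCount_log_three hinj' (zero_lt_one.trans_le hx), Fin.sum_univ_three]
  have hpi := Real.pi_ne_zero
  simp only [Matrix.cons_val]
  field_simp
  ring

theorem corollary15 :
    (∀ a b c : ℕ, a < b → b < c → Nat.gcd a (Nat.gcd b c) = 1 →
      Function.Injective (fun t : ℕ × ℕ × ℕ => a ^ t.1 * b ^ t.2.1 * c ^ t.2.2) →
      (∃ δ : ℝ, 0 < δ ∧ (separatedAtTop a b c δ).NeBot) ∧
      ∀ x : ℝ, 1 ≤ x → ∃ P₁ P₂ P₃ Q : ℝ,
        (∀ δ : ℝ, 0 < δ →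
          Tendsto (fun R => cotCosSum a b x R + cotCosSum b a x R)
            (separatedAtTop a b c δ) (𝓝 P₁) ∧
          Tendsto (fun R => cotCosSum b c x R + cotCosSum c b x R)
            (separatedAtTop a b c δ) (𝓝 P₂) ∧
          Tendsto (fun R => cotCosSum c a x R + cotCosSum a c x R)
            (separatedAtTop a b c δ) (𝓝 P₃) ∧
          Tendsto (fun R => cotCotSinSum a b c x R + cotCotSinSum b a c x R
              + cotCotSinSum c a b x R)
            (separatedAtTop a b c δ) (𝓝 Q)) ∧
        (smoothCount a b c x : ℝ) =
          cubicPart a b c x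
            - 1 / 4 * bernoulliOneStar (Real.log x / Real.log a)
            - 1 / 4 * bernoulliOneStar (Real.log x / Real.log b)
            - 1 / 4 * bernoulliOneStar (Real.log x / Real.log c)
            - 1 / (4 * Real.pi) * P₁ - 1 / (4 * Real.pi) * P₂ - 1 / (4 * Real.pi) * P₃
            - 1 / (4 * Real.pi) * Q
            + 1 / 2 * smoothChar a b c x) ∧
    ((∃ δ : ℝ, 0 < δ ∧ (separatedAtTop 2 3 5 δ).NeBot) ∧
     ∀ x : ℝ, 1 ≤ x → ∃ P₁ P₂ P₃ Q : ℝ,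
       (∀ δ : ℝ, 0 < δ →
         Tendsto (fun R => cotCosSum 2 3 x R + cotCosSum 3 2 x R)
           (separatedAtTop 2 3 5 δ) (𝓝 P₁) ∧
         Tendsto (fun R => cotCosSum 3 5 x R + cotCosSum 5 3 x R)
           (separatedAtTop 2 3 5 δ) (𝓝 P₂) ∧
         Tendsto (fun R => cotCosSum 5 2 x R + cotCosSum 2 5 x R)
           (separatedAtTop 2 3 5 δ) (𝓝 P₃) ∧
         Tendsto (fun R => cotCotSinSum 2 3 5 x R + cotCotSinSum 3 2 5 x R
             + cotCotSinSum 5 2 3 x R)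
           (separatedAtTop 2 3 5 δ) (𝓝 Q)) ∧
       (smoothCount 2 3 5 x : ℝ) =
         cubicPart 2 3 5 x
           - 1 / 4 * bernoulliOneStar (Real.log x / Real.log 2)
           - 1 / 4 * bernoulliOneStar (Real.log x / Real.log 3)
           - 1 / 4 * bernoulliOneStar (Real.log x / Real.log 5)
           - 1 / (4 * Real.pi) * P₁ - 1 / (4 * Real.pi) * P₂ - 1 / (4 * Real.pi) * P₃
           - 1 / (4 * Real.pi) * Q
           + 1 / 2 * smoothChar 2 3 5 x) := by
  exact ⟨fun _ _ _ _ _ _ hinj => corollary15_general hinj,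
    by simpa only [Nat.cast_ofNat] using corollary15_general injective_two_three_five⟩
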